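/- Let $n,d\ge 1$, $1<p<\infty$ and $p'=p/(p-1)$. A matrix weight is a locally integrable function $W:\mathbb{R}^d\to M_n(\mathbb{C})$ that is positive definite a.e.; for a cube $Q\subset\mathbb{R}^d$ (sides parallel to the axes) and $e\in\mathbb{C}^n$ put $\rho_{Q}(e)=\big(\frac1{|Q|}\int_Q|W^{1/p}(x)e|^p\,dx\big)^{1/p}$. $W$ is a matrix $A_{p,\infty}$ weight with constant $K$ if $$\exp\Big(\frac1{|Q|}\int_Q\log|W^{-1/p}(x)z|\,dx\Big)\le K\sup_{u\ne0}\frac{|\langle u,z\rangle|}{\rho_{Q}(u)}$$ for all cubes $Q$ and all $z\in\mathbb{C}^n\setminus\{0\}$ (in particular the integral on the left is finite). Let $\mathscr{D}$ be a dyadic grid in $\mathbb{R}^d$, and for each cube $I=I_1\times\cdots\times I_d\in\mathscr{D}$ let $V_I$ be a positive definite matrix with $c_1|V_Ie|\le\rho_I(e)\le c_2|V_Ie|$ for all $e\in\mathbb{C}^n$, where $c_1,c_2>0$ do not depend on $I$. For an interval $J$ with left and right halves $J_\ell,J_r$ let $h_J^1=|J|^{-1/2}\chi_J$ and $h_J^0=|J|^{-1/2}(\chi_{J_\ell}-\chi_{J_r})$.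 For $\varepsilon\in\mathscr{S}=\{0,1\}^d\setminus\{(1,\dots,1)\}$ let $h_I^\varepsilon(x)=\prod_{i=1}^d h_{I_i}^{\varepsilon_i}(x_i)$ and $\vec f_I^{\,\varepsilon}=\int_{\mathbb{R}^d}\vec f\,h_I^\varepsilon\,dx$. Finally, for a matrix weight $U$ and $1<r<\infty$, let $L^r(U)$ be the space of measurable $\vec f:\mathbb{R}^d\to\mathbb{C}^n$ with $\|\vec f\|_{L^r(U)}=\big(\int_{\mathbb{R}^d}|U^{1/r}(x)\vec f(x)|^r\,dx\big)^{1/r}<\infty$, and use the same notation for $U=W^{1-p'}$, whether or not it is locally integrable. Then there is a constant $C$ that depends only on $n$, $d$, $p$, $K$, $c_1$, $c_2$, such that for every matrix $A_{p,\infty}$ weight $W$ with constant $K$, every dyadic grid $\mathscr{D}$, every such family $(V_I)_{I\in\mathscr{D}}$ and every $\vec f\in L^{p'}(W^{1-p'})$, $$\left(\int_{\mathbb{R}^d}\Big(\sum_{I\in\mathscr{D}}\sum_{\varepsilon\in\mathscr{S}}\frac{|V_I^{-1}\vec f_I^{\,\varepsilon}|^2}{|I|}\chi_I(x)\Big)^{p'/2}dx\right)^{1/p'}\le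 C\,\|\vec f\|_{L^{p'}(W^{1-p'})}.$$ -/

import Mathlib

open MeasureTheory
open scoped ENNReal NNReal ComplexOrder

noncomputable section

namespace MatrixWeight

/-- The vector space `ℂⁿ` with its Euclidean norm. -/
abbrev Vec (n : ℕ) : Type := EuclideanSpace ℂ (Fin n)

/-- The algebra of complex `n × n` matrices. -/
abbrev Mat (n : ℕ) : Type := Matrix (Fin n) (Fin n) ℂ

/-- The action of a matrix on a vector of `ℂⁿ`. -/
def act {n : ℕ} (A : Mat n) (v : Vec n) : Vec n := WithLp.toLp 2 (A.mulVec v.ofLp)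

/-- The real power `A ^ s` of a (positive definite) Hermitian matrix, by functional calculus. -/
def matPow {n : ℕ} (A : Mat n) (s : ℝ) : Mat n := cfc (fun t : ℝ => t ^ s) A

/-- The half-open cube in `ℝᵈ` with lower corner `a` and side length `ℓ`. -/
def cube {d : ℕ} (a : Fin d → ℝ) (ℓ : ℝ) : Set (Fin d → ℝ) :=
  Set.univ.pi fun i => Set.Ico (a i) (a i + ℓ)

/-- A matrix weight on `ℝᵈ`: locally integrable and positive definite almost everywhere. -/
structure IsMatrixWeight {n d : ℕ} (W : (Fin d → ℝ) → Mat n) : Prop where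
  locallyIntegrable : ∀ i j, LocallyIntegrable (fun x => W x i j) volume
  posDef : ∀ᵐ x ∂(volume : Measure (Fin d → ℝ)), (W x).PosDef

/-- The norm `ρ_{Q,p}(e) = (|Q|⁻¹ ∫_Q |W^{1/p}(x) e|^p dx)^{1/p} = |Q|^{-1/p} ‖χ_Q W^{1/p} e‖_{L^p}`
on `ℂⁿ`. -/
def avgNorm {n d : ℕ} (p : ℝ) (W : (Fin d → ℝ) → Mat n) (Q : Set (Fin d → ℝ)) (e : Vec n) : ℝ :=
  (⨍ x in Q, ‖act (matPow (W x) (1 / p)) e‖ ^ p) ^ (1 / p)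

/-- The norm dual to `ρ_{Q,p}`: `z ↦ sup_u |⟨u, z⟩| / ρ_{Q,p}(u)`. For a matrix weight the supremum
is over a bounded set; `u = 0` contributes `0`. -/
def dualAvgNorm {n d : ℕ} (p : ℝ) (W : (Fin d → ℝ) → Mat n) (Q : Set (Fin d → ℝ))
    (z : Vec n) : ℝ :=
  ⨆ u : Vec n, ‖inner ℂ u z‖ / avgNorm p W Q u

/-- `W` is a matrix `A_{p,∞}` weight with constant `K`: on every cube `Q`, the geometric mean of the
dual norms `|W^{-1/p}(x) z|` is at most `K` times the dual of the norm `ρ_{Q,p}`.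
The negative part of `log |W^{-1/p} z|` is integrable on `Q` for every matrix weight, so that the
integrability clause says that the geometric mean is finite. -/
structure IsMatrixApInftyWith {n d : ℕ} (p K : ℝ) (W : (Fin d → ℝ) → Mat n) : Prop where
  isMatrixWeight : IsMatrixWeight W
  integrableOn_log : ∀ (a : Fin d → ℝ) (ℓ : ℝ), 0 < ℓ → ∀ z : Vec n, z ≠ 0 →
    IntegrableOn (fun x => Real.log ‖act (matPow (W x) (-(1 / p))) z‖) (cube a ℓ) volume
  exp_average_log_le : ∀ (a : Fin d → ℝ) (ℓ : ℝ), 0 < ℓ → ∀ z : Vec n, z ≠ 0 →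
    Real.exp (⨍ x in cube a ℓ, Real.log ‖act (matPow (W x) (-(1 / p))) z‖)
      ≤ K * dualAvgNorm p W (cube a ℓ) z

/-- A dyadic grid in `ℝᵈ`. The cubes of generation `k` have side length `2 ^ k` and their lower
corners form the lattice `shift k + 2 ^ k ℤᵈ`; the last field says that every cube of generation
`k + 1` is the union of `2 ^ d` cubes of generation `k`. -/
structure DyadicGrid (d : ℕ) where
  shift : ℤ → Fin d → ℝ
  nested : ∀ (k : ℤ) (i : Fin d), ∃ j : ℤ, shift (k + 1) i = shift k i + j * (2 : ℝ) ^ k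

/-- The lower corner of the `m`-th cube of generation `k`. -/
def DyadicGrid.corner {d : ℕ} (D : DyadicGrid d) (k : ℤ) (m : Fin d → ℤ) : Fin d → ℝ :=
  fun i => D.shift k i + m i * (2 : ℝ) ^ k

/-- The `m`-th cube of generation `k`. -/
def DyadicGrid.cube {d : ℕ} (D : DyadicGrid d) (k : ℤ) (m : Fin d → ℤ) : Set (Fin d → ℝ) :=
  MatrixWeight.cube (D.corner k m) ((2 : ℝ) ^ k)

/-- The one-dimensional functions `h_I^1 = |I|^{-1/2} χ_I` (for `true`) and
`h_I^0 = |I|^{-1/2} (χ_{I_ℓ} - χ_{I_r})` (for `false`) of the interval `I = [a, a + ℓ)`. -/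
def haarOne (b : Bool) (a ℓ t : ℝ) : ℝ :=
  (Real.sqrt ℓ)⁻¹ *
    (if b then (Set.Ico a (a + ℓ)).indicator (fun _ => 1) t
      else (Set.Ico a (a + ℓ / 2)).indicator (fun _ => 1) t
        - (Set.Ico (a + ℓ / 2) (a + ℓ)).indicator (fun _ => 1) t)

/-- The function `h_I^ε` of a dyadic cube `I = I_1 × ⋯ × I_d`. -/
def DyadicGrid.haar {d : ℕ} (D : DyadicGrid d) (k : ℤ) (m : Fin d → ℤ) (ε : Fin d → Bool)
    (x : Fin d → ℝ) : ℝ :=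
  ∏ i, haarOne (ε i) (D.corner k m i) ((2 : ℝ) ^ k) (x i)

/-- The vector Haar coefficient `f_I^ε = ∫ f h_I^ε`. -/
def DyadicGrid.haarCoeff {n d : ℕ} (D : DyadicGrid d) (f : (Fin d → ℝ) → Vec n) (k : ℤ)
    (m : Fin d → ℤ) (ε : Fin d → Bool) : Vec n :=
  ∫ x, D.haar k m ε x • f x

/-- The index set `{0,1}^d` without the all-ones vector. -/
def signatures (d : ℕ) : Finset (Fin d → Bool) :=
  Finset.univ.filter fun ε => ε ≠ fun _ => true

/-- A family of positive definite matrices `V_I`, indexed by the cubes of the grid, with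
`c₁ |V_I e| ≤ |I|^{-1/p} ‖χ_I W^{1/p} e‖_{L^p} ≤ c₂ |V_I e|` for all vectors `e`. -/
structure IsReducingFamily {n d : ℕ} (p c₁ c₂ : ℝ) (W : (Fin d → ℝ) → Mat n) (D : DyadicGrid d)
    (V : ℤ → (Fin d → ℤ) → Mat n) : Prop where
  posDef : ∀ k m, (V k m).PosDef
  lower : ∀ k m (e : Vec n), c₁ * ‖act (V k m) e‖ ≤ avgNorm p W (D.cube k m) e
  upper : ∀ k m (e : Vec n), avgNorm p W (D.cube k m) e ≤ c₂ * ‖act (V k m) e‖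

/-- The square of the square function, `∑_I ∑_ε |V_I⁻¹ f_I^ε|² χ_I(x) / |I|`. -/
def sqSum {n d : ℕ} (D : DyadicGrid d) (V : ℤ → (Fin d → ℤ) → Mat n) (f : (Fin d → ℝ) → Vec n)
    (x : Fin d → ℝ) : ℝ≥0∞ :=
  ∑' (k : ℤ) (m : Fin d → ℤ), ∑ ε ∈ signatures d,
    (D.cube k m).indicator
      (fun _ => ‖act (V k m)⁻¹ (D.haarCoeff f k m ε)‖ₑ ^ 2 / volume (D.cube k m)) x

/-- The norm of `L^r(U)`: `(∫ |U^{1/r}(x) f(x)|^r dx)^{1/r}`. -/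
def weightedLpNorm {n d : ℕ} (r : ℝ) (U : (Fin d → ℝ) → Mat n) (f : (Fin d → ℝ) → Vec n) : ℝ≥0∞ :=
  (∫⁻ x, ‖act (matPow (U x) (1 / r)) (f x)‖ₑ ^ r) ^ (1 / r)

/-- Membership in the weighted space `L^r(U)`. -/
def MemWeightedLp {n d : ℕ} (r : ℝ) (U : (Fin d → ℝ) → Mat n) (f : (Fin d → ℝ) → Vec n) : Prop :=
  AEStronglyMeasurable f volume ∧ weightedLpNorm r U f < ∞

end MatrixWeight

end

/-!
With `g = W^{-1/p} f` the claim is that the square function of `W^{1/p} g`, renormalized on each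
cube `I` by `V_I⁻¹`, is bounded on `L^{p'}`.

Only finitely many generations of cubes matter at a time. Below a cube of the largest generation
they form a homogeneous tree, encoded as `List σ` with `σ = Fin d → Bool`: the root is `[]`, and the
children of `l` are the lists `c :: l`. Everything is expressed by averages over the dyadic cubes,
which are martingales on the tree, and the constants do not depend on its depth. This avoids maximal
functions and differentiation of integrals on `ℝᵈ`: the estimates are inductions over the tree,
most of them the verification that some process is a supermartingale (`treeAvg_le_of_supermart`).

* The pairing of `u` and `z` is at most `|W^{1/p} u| |W^{-1/p} z|`. Hence the `A_{p,∞}` condition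
  says that `|V_I⁻¹ z|` is comparable to the geometric mean of `|W^{-1/p} z|` on `I`
  (`norm_act_inv_le`, `exp_average_log_invRootNorm_le`), and that the scalar weights
  `|W^{1/p} e| ^ p` have averages comparable to their geometric means (`log_average_rootNorm_le`).
* The second fact gives a reverse Hölder inequality for the scalar weights, by an explicit Bellman
  function (`exists_reverse_holder`). Therefore the average of `|V_J⁻¹ W^{1/p} g|` over `J` is at
  most a constant times `G J`, the `L ^ q'` mean over `J`, with an exponent `q' < p'`, of the
  function formed by the `L ^ p'` means of `g` over the smallest cubes of the tree.
* By the first fact, `|V_I⁻¹ V_J|` for `I ⊆ J` is controlled by the exponential of a nonnegative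
  martingale that is bounded at `J`. Together with the weak-type bounds for the majorant of
  `V_J⁻¹ f` and for its square function this shows that outside at most half of `J` no cube `I` is
  bad: neither is `V_I⁻¹ V_J` large, nor the majorant, nor the square function of `V_J⁻¹ f` up to
  `I` (`treeAvg_stopped_le`).
* Above the maximal bad cubes the square function is at most a multiple of `G J`. Iterating inside
  the bad cubes bounds the pairing of the square function with `φ ≥ 0` by that of the maximal
  functions of `G` and `φ` (`treeAvg_sqrt_pathSum_mul_le`).
* Taking for `φ` the power `p' - 1` of the square function, Doob's inequality
  (`exists_treeAvg_runMax_le`) for both maximal functions concludes the proof on the tree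
  (`exists_treeAvg_pathSum_rpow_le`).

The Haar coefficients enter only through `DyadicGrid.sum_haarCoeff_le`: those of `I` are bounded by
the variance of the averages over the dyadic children of `I`.
-/

namespace MatrixWeight

/-! ### Averages over a finite homogeneous tree -/

section Path

variable {σ : Type*}

/-- The sum of `a` over the proper ancestors of a node. -/
def pathSum (a : List σ → ℝ) : List σ → ℝ
  | [] => 0
  | _ :: l => pathSum a l + a l

/-- The maximum of `F` over a node and all its ancestors. -/
noncomputable def runMax (F : List σ → ℝ) : List σ → ℝ
  | [] => F []
  | c :: l => max (F (c :: l)) (runMax F l)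

lemma le_runMax_append (F : List σ → ℝ) (v l : List σ) : F l ≤ runMax F (v ++ l) := by
  induction v with
  | nil => cases l with
    | nil => exact le_rfl
    | cons c l => exact le_max_left _ _
  | cons c v ih => exact ih.trans (le_max_right _ _)

lemma runMax_nonneg {F : List σ → ℝ} (hF : ∀ l, 0 ≤ F l) (l : List σ) : 0 ≤ runMax F l :=
  (hF l).trans (le_runMax_append F [] l)

lemma runMax_rpow {F : List σ → ℝ} (hF : ∀ l, 0 ≤ F l) {s : ℝ} (hs : 0 ≤ s) (l : List σ) :
    runMax (fun u => F u ^ s) l = runMax F l ^ s := by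
  induction l with
  | nil => rfl
  | cons c l ih =>
    have hm := (Real.monotoneOn_rpow_Ici_of_exponent_nonneg hs).map_max (hF (c :: l))
      (runMax_nonneg hF l)
    simp only [runMax, ih, hm]

end Path

section Tree

variable {σ : Type*} [Fintype σ]

/-- The average of `F` over the children `c :: l` of the node `l` of the tree `List σ`. -/
noncomputable def childAvg {E : Type*} [AddCommGroup E] [Module ℝ E] (F : List σ → E)
    (l : List σ) : E :=
  (Fintype.card σ : ℝ)⁻¹ • ∑ c, F (c :: l)

/-- The average of `F` over the descendants of `l` that lie `j` generations below `l`. -/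
noncomputable def treeAvg (j : ℕ) (F : List σ → ℝ) : List σ → ℝ :=
  childAvg^[j] F

/-- `F` is a martingale up to generation `N`: its value at a node of smaller generation is the
average of its values at the children. -/
def IsTreeMart {E : Type*} [AddCommGroup E] [Module ℝ E] (N : ℕ) (F : List σ → E) : Prop :=
  ∀ l : List σ, l.length < N → childAvg F l = F l

@[simp] lemma treeAvg_zero (F : List σ → ℝ) (l : List σ) : treeAvg 0 F l = F l := rfl

lemma treeAvg_succ (j : ℕ) (F : List σ → ℝ) (l : List σ) :
    treeAvg (j + 1) F l = childAvg (treeAvg j F) l := by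
  rw [treeAvg, Function.iterate_succ_apply']; rfl

section Vector

variable {E : Type*} [AddCommGroup E] [Module ℝ E]

lemma childAvg_congr {F G : List σ → E} {l : List σ} (h : ∀ c, F (c :: l) = G (c :: l)) :
    childAvg F l = childAvg G l := by
  simp only [childAvg, h]

lemma childAvg_map {E' : Type*} [AddCommGroup E'] [Module ℝ E'] (T : E →ₗ[ℝ] E')
    (F : List σ → E) (l : List σ) : childAvg (fun u => T (F u)) l = T (childAvg F l) := by
  simp [childAvg]

lemma childAvg_append (F : List σ → E) (J l : List σ) :
    childAvg (fun u => F (u ++ J)) l = childAvg F (l ++ J) := rfl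

lemma IsTreeMart.append {N : ℕ} {F : List σ → E} (h : IsTreeMart N F) (J : List σ) {M : ℕ}
    (hM : M + J.length ≤ N) : IsTreeMart M fun u => F (u ++ J) := fun l hl => by
  rw [childAvg_append]
  exact h _ (by simp; omega)

lemma IsTreeMart.map {E' : Type*} [AddCommGroup E'] [Module ℝ E'] {N : ℕ} {F : List σ → E}
    (h : IsTreeMart N F) (T : E →ₗ[ℝ] E') : IsTreeMart N fun u => T (F u) := fun l hl => by
  rw [childAvg_map, h l hl]

lemma IsTreeMart.mono {N M : ℕ} {F : List σ → E} (h : IsTreeMart N F) (hM : M ≤ N) :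
    IsTreeMart M F := fun l hl => h l (by omega)

lemma childAvg_const [Nonempty σ] (x : E) (l : List σ) :
    childAvg (fun _ : List σ => x) l = x := by
  have : (Fintype.card σ : ℝ) ≠ 0 := by simp
  simp only [childAvg, Finset.sum_const, Finset.card_univ, ← Nat.cast_smul_eq_nsmul ℝ, smul_smul,
    inv_mul_cancel₀ this, one_smul]

lemma childAvg_add (F G : List σ → E) (l : List σ) :
    childAvg (fun u => F u + G u) l = childAvg F l + childAvg G l := by
  simp only [childAvg, Finset.sum_add_distrib, smul_add]

lemma childAvg_sub (F G : List σ → E) (l : List σ) :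
    childAvg (fun u => F u - G u) l = childAvg F l - childAvg G l := by
  simp only [childAvg, Finset.sum_sub_distrib, smul_sub]

end Vector

lemma childAvg_mono {F G : List σ → ℝ} {l : List σ} (h : ∀ c, F (c :: l) ≤ G (c :: l)) :
    childAvg F l ≤ childAvg G l := by
  unfold childAvg
  exact smul_le_smul_of_nonneg_left (Finset.sum_le_sum fun c _ => h c) (by positivity)

lemma childAvg_nonneg {F : List σ → ℝ} {l : List σ} (h : ∀ c, 0 ≤ F (c :: l)) :
    0 ≤ childAvg F l := by
  unfold childAvg
  exact smul_nonneg (by positivity) (Finset.sum_nonneg fun c _ => h c)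

lemma childAvg_const_mul (x : ℝ) (F : List σ → ℝ) (l : List σ) :
    childAvg (fun u => x * F u) l = x * childAvg F l :=
  childAvg_map (LinearMap.mul ℝ ℝ x) F l

lemma childAvg_div_const (x : ℝ) (F : List σ → ℝ) (l : List σ) :
    childAvg (fun u => F u / x) l = childAvg F l / x := by
  simpa only [div_eq_inv_mul] using childAvg_const_mul x⁻¹ F l

lemma treeAvg_mono {j : ℕ} {F G : List σ → ℝ} {l : List σ}
    (h : ∀ v : List σ, v.length = j → F (v ++ l) ≤ G (v ++ l)) :
    treeAvg j F l ≤ treeAvg j G l := by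
  induction j generalizing l with
  | zero => exact h [] rfl
  | succ j ih =>
    rw [treeAvg_succ, treeAvg_succ]
    refine childAvg_mono fun c => ih fun v hv => ?_
    have := h (v ++ [c]) (by simp [hv])
    simpa using this

lemma treeAvg_congr {j : ℕ} {F G : List σ → ℝ} {l : List σ}
    (h : ∀ v : List σ, v.length = j → F (v ++ l) = G (v ++ l)) :
    treeAvg j F l = treeAvg j G l :=
  le_antisymm (treeAvg_mono fun v hv => (h v hv).le) (treeAvg_mono fun v hv => (h v hv).ge)

lemma treeAvg_append (j : ℕ) (F : List σ → ℝ) (J l : List σ) :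
    treeAvg j (fun u => F (u ++ J)) l = treeAvg j F (l ++ J) := by
  induction j generalizing l with
  | zero => rfl
  | succ j ih =>
    rw [treeAvg_succ, treeAvg_succ, ← childAvg_append]
    exact childAvg_congr fun c => ih _

lemma treeAvg_const_mul (j : ℕ) (x : ℝ) (F : List σ → ℝ) (l : List σ) :
    treeAvg j (fun u => x * F u) l = x * treeAvg j F l := by
  induction j generalizing l with
  | zero => rfl
  | succ j ih =>
    rw [treeAvg_succ, treeAvg_succ, ← childAvg_const_mul]
    exact childAvg_congr fun c => ih _

lemma treeAvg_add (j : ℕ) (F G : List σ → ℝ) (l : List σ) :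
    treeAvg j (fun u => F u + G u) l = treeAvg j F l + treeAvg j G l := by
  induction j generalizing l with
  | zero => rfl
  | succ j ih =>
    rw [treeAvg_succ, treeAvg_succ, treeAvg_succ, ← childAvg_add]
    exact childAvg_congr fun c => ih _

lemma treeAvg_sum {ι : Type*} (s : Finset ι) (j : ℕ) (F : ι → List σ → ℝ) (l : List σ) :
    treeAvg j (fun u => ∑ i ∈ s, F i u) l = ∑ i ∈ s, treeAvg j (F i) l := by
  classical
  induction s using Finset.induction_on with
  | empty =>
    simpa using treeAvg_const_mul j 0 (fun _ => 0) l
  | insert i s hi ih =>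
    simp only [Finset.sum_insert hi]
    rw [treeAvg_add, ih]

lemma treeAvg_nonneg {j : ℕ} {F : List σ → ℝ} {l : List σ}
    (h : ∀ v : List σ, v.length = j → 0 ≤ F (v ++ l)) : 0 ≤ treeAvg j F l := by
  have := treeAvg_const_mul j 0 F l
  simp only [zero_mul] at this
  rw [← this]
  exact treeAvg_mono h

lemma treeAvg_const [Nonempty σ] (j : ℕ) (x : ℝ) (l : List σ) :
    treeAvg j (fun _ : List σ => x) l = x := by
  induction j generalizing l with
  | zero => rfl
  | succ j ih =>
    rw [treeAvg_succ]
    refine Eq.trans ?_ (childAvg_const (σ := σ) x l)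
    exact childAvg_congr fun c => ih _

/-- Averages of a supermartingale decrease. -/
lemma treeAvg_le_of_supermart {j : ℕ} {X : List σ → ℝ} {l : List σ}
    (h : ∀ v : List σ, v.length < j → childAvg X (v ++ l) ≤ X (v ++ l)) :
    treeAvg j X l ≤ X l := by
  induction j generalizing l with
  | zero => exact le_rfl
  | succ j ih =>
    rw [treeAvg_succ]
    refine (childAvg_mono fun c => ih fun v hv => ?_).trans (h [] (by simp))
    have := h (v ++ [c]) (by simp; omega)
    simpa using this

lemma IsTreeMart.treeAvg_eq {N : ℕ} {F : List σ → ℝ} (h : IsTreeMart N F) {j : ℕ} {l : List σ}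
    (hj : j + l.length ≤ N) : treeAvg j F l = F l := by
  induction j generalizing l with
  | zero => rfl
  | succ j ih =>
    rw [treeAvg_succ, ← h l (by omega)]
    exact childAvg_congr fun c => ih (by simp; omega)

/-- The conditional expectations of a function of the nodes of generation `N` form a
martingale. -/
lemma isTreeMart_treeAvg (N : ℕ) (F : List σ → ℝ) :
    IsTreeMart N fun l : List σ => treeAvg (N - l.length) F l := fun l hl => by
  obtain ⟨k, hk⟩ : ∃ k, N - l.length = k + 1 := ⟨N - l.length - 1, by omega⟩
  beta_reduce
  rw [hk, treeAvg_succ]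
  refine childAvg_congr fun c => ?_
  congr 1
  simp; omega

lemma norm_childAvg_le {E : Type*} [NormedAddCommGroup E] [NormedSpace ℝ E] (F : List σ → E)
    (l : List σ) : ‖childAvg F l‖ ≤ childAvg (fun u => ‖F u‖) l := by
  unfold childAvg
  rw [norm_smul, Real.norm_of_nonneg (by positivity), smul_eq_mul]
  gcongr
  exact norm_sum_le _ _

lemma IsTreeMart.norm_le_treeAvg {E : Type*} [NormedAddCommGroup E] [NormedSpace ℝ E] {N : ℕ}
    {F : List σ → E} (h : IsTreeMart N F) {j : ℕ} {l : List σ} (hj : j + l.length ≤ N) :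
    ‖F l‖ ≤ treeAvg j (fun u => ‖F u‖) l := by
  induction j generalizing l with
  | zero => exact le_rfl
  | succ j ih =>
    rw [treeAvg_succ, ← h l (by omega)]
    exact (norm_childAvg_le _ _).trans (childAvg_mono fun c => ih (by simp; omega))

/-- Regularity of the tree: a nonnegative martingale grows at most by the factor `#σ` in one
step. -/
lemma le_card_mul_childAvg [Nonempty σ] {F : List σ → ℝ} {l : List σ} (h : ∀ c, 0 ≤ F (c :: l))
    (c : σ) : F (c :: l) ≤ Fintype.card σ * childAvg F l := by
  have : (Fintype.card σ : ℝ) ≠ 0 := by simp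
  rw [childAvg, smul_eq_mul, mul_inv_cancel_left₀ this]
  exact Finset.single_le_sum (f := fun c => F (c :: l)) (fun c _ => h c) (Finset.mem_univ c)

lemma treeAvg_pos [Nonempty σ] {j : ℕ} {F : List σ → ℝ} {l : List σ}
    (h : ∀ v : List σ, v.length = j → 0 < F (v ++ l)) : 0 < treeAvg j F l := by
  induction j generalizing l with
  | zero => exact h [] rfl
  | succ j ih =>
    rw [treeAvg_succ, childAvg, smul_eq_mul]
    have : (0:ℝ) < Fintype.card σ := by exact_mod_cast Fintype.card_pos
    refine mul_pos (by positivity) (Finset.sum_pos (fun c _ => ih fun v hv => ?_)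
      Finset.univ_nonempty)
    simpa using h (v ++ [c]) (by simp [hv])

/-- Hölder's inequality for `treeAvg`. -/
lemma treeAvg_mul_le_of_pos {j : ℕ} {F G : List σ → ℝ} {l : List σ} [Nonempty σ] {q q' : ℝ}
    (hq : q.HolderConjugate q')
    (hF : ∀ v : List σ, v.length = j → 0 < F (v ++ l))
    (hG : ∀ v : List σ, v.length = j → 0 < G (v ++ l)) :
    treeAvg j (fun u => F u * G u) l
      ≤ treeAvg j (fun u => F u ^ q) l ^ (1 / q) * treeAvg j (fun u => G u ^ q') l ^ (1 / q') := by
  set X := treeAvg j (fun u => F u ^ q) l with hX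
  set Y := treeAvg j (fun u => G u ^ q') l with hY
  have X0 : 0 < X := treeAvg_pos fun v hv => Real.rpow_pos_of_pos (hF v hv) _
  have Y0 : 0 < Y := treeAvg_pos fun v hv => Real.rpow_pos_of_pos (hG v hv) _
  have hq0 := hq.pos
  have hq0' := hq.symm.pos
  have key : treeAvg j (fun u => F u * G u) l ≤ treeAvg j (fun u =>
      (X ^ (1 / q) * Y ^ (1 / q')) * (1 / (q * X) * F u ^ q + 1 / (q' * Y) * G u ^ q')) l := by
    refine treeAvg_mono fun v hv => ?_
    have f0 := hF v hv
    have g0 := hG v hv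
    have hy := Real.young_inequality_of_nonneg (a := F (v ++ l) / X ^ (1 / q))
      (b := G (v ++ l) / Y ^ (1 / q')) (by positivity) (by positivity) hq
    rw [Real.div_rpow f0.le (by positivity), Real.div_rpow g0.le (by positivity),
      ← Real.rpow_mul X0.le, ← Real.rpow_mul Y0.le, one_div_mul_cancel hq0.ne',
      one_div_mul_cancel hq0'.ne', Real.rpow_one, Real.rpow_one] at hy
    have hXq : 0 < X ^ (1 / q) := by positivity
    have hYq : 0 < Y ^ (1 / q') := by positivity
    calc F (v ++ l) * G (v ++ l) = (X ^ (1 / q) * Y ^ (1 / q')) *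
          (F (v ++ l) / X ^ (1 / q) * (G (v ++ l) / Y ^ (1 / q'))) := by field_simp
      _ ≤ (X ^ (1 / q) * Y ^ (1 / q')) * (F (v ++ l) ^ q / X / q + G (v ++ l) ^ q' / Y / q') := by
          gcongr
      _ = _ := by field_simp
  refine key.trans (le_of_eq ?_)
  rw [treeAvg_const_mul, treeAvg_add, treeAvg_const_mul, treeAvg_const_mul, ← hX, ← hY]
  have := hq.inv_add_inv_eq_one
  have e : 1 / (q * X) * X + 1 / (q' * Y) * Y = 1 := by
    rw [one_div, one_div, mul_inv, mul_inv, inv_mul_cancel_right₀ X0.ne',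
      inv_mul_cancel_right₀ Y0.ne', this]
  rw [e, mul_one]

/-! ### Doob's maximal inequality -/

/-- Young's inequality with a small parameter, used to absorb terms. -/
lemma exists_young {s s' : ℝ} (h : s.HolderConjugate s') {ε : ℝ} (hε : 0 < ε) :
    ∃ C : ℝ, 0 < C ∧ ∀ x y : ℝ, 0 ≤ x → 0 ≤ y → x * y ≤ C * x ^ s + ε * y ^ s' := by
  refine ⟨(ε ^ (-(1 / s'))) ^ s, by positivity, fun x y hx hy => ?_⟩
  have hy' := Real.young_inequality_of_nonneg (a := ε ^ (-(1 / s')) * x) (b := ε ^ (1 / s') * y)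
    (by positivity) (by positivity) h
  have h0 := h.pos
  have h0' := h.symm.pos
  have e1 : ε ^ (-(1 / s')) * x * (ε ^ (1 / s') * y) = x * y := by
    rw [Real.rpow_neg hε.le]; field_simp
  rw [e1, Real.mul_rpow (by positivity) hx, Real.mul_rpow (by positivity) hy,
    ← Real.rpow_mul hε.le (1 / s'), one_div_mul_cancel h0'.ne', Real.rpow_one] at hy'
  refine hy'.trans (add_le_add (div_le_self (by positivity) h.lt.le)
    (div_le_self (by positivity) h.symm.lt.le))

/-- Doob's maximal inequality. With `s'` the conjugate exponent of `s`, the process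
`M ^ s - s' M ^ (s - 1) F`, where `M` is the running maximum of `F`, is a supermartingale. -/
lemma exists_treeAvg_runMax_le {s s' : ℝ} (h : s.HolderConjugate s') : ∃ C : ℝ, 0 < C ∧
    ∀ (σ : Type) [Fintype σ] [Nonempty σ] (N : ℕ) (F : List σ → ℝ), IsTreeMart N F →
      (∀ l, 0 ≤ F l) →
      treeAvg N (fun u => runMax F u ^ s) [] ≤ C * treeAvg N (fun u => F u ^ s) [] := by
  have h0 := h.pos
  have h0' := h.symm.pos
  have h1 := h.lt
  obtain ⟨C, hC, hY⟩ := exists_young h (ε := 1 / (2 * s')) (by positivity)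
  refine ⟨2 * (s' * C), by positivity, fun σ _ _ N F hF F0 => ?_⟩
  have M0 := runMax_nonneg F0
  have hs1 : (s - 1) * s' = s := h.sub_one_mul_conj
  have hsup : treeAvg N (fun u => runMax F u ^ s - s' * (runMax F u ^ (s - 1) * F u)) []
      ≤ runMax F [] ^ s - s' * (runMax F [] ^ (s - 1) * F []) := by
    refine treeAvg_le_of_supermart
      (X := fun u => runMax F u ^ s - s' * (runMax F u ^ (s - 1) * F u)) fun v hv => ?_
    simp only [List.append_nil]
    rw [← hF v hv]
    have : runMax F v ^ s - s' * (runMax F v ^ (s - 1) * childAvg F v)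
        = childAvg (fun u => runMax F v ^ s - s' * runMax F v ^ (s - 1) * F u) v := by
      rw [childAvg_sub, childAvg_const, childAvg_const_mul, mul_assoc]
    rw [this]
    refine childAvg_mono fun c => ?_
    set M := runMax F v
    set y := F (c :: v) with hy
    have y0 : 0 ≤ y := F0 _
    have m0 : 0 ≤ M := M0 v
    change max y M ^ s - s' * (max y M ^ (s - 1) * y) ≤ M ^ s - s' * M ^ (s - 1) * y
    rcases le_or_gt y M with hyM | hyM
    · rw [max_eq_right hyM]; apply le_of_eq; ring
    · rw [max_eq_left hyM.le]
      have hyp : 0 < y := m0.trans_lt hyM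
      have e : y ^ (s - 1) * y = y ^ s := by
        rw [← Real.rpow_add_one hyp.ne']; ring_nf
      have hyoung := Real.young_inequality_of_nonneg (a := y) (b := M ^ (s - 1)) y0
        (by positivity) h
      rw [← Real.rpow_mul m0, hs1] at hyoung
      have e2 : s' * (y ^ s / s + M ^ s / s') = (s' - 1) * y ^ s + M ^ s := by
        have : s' / s = s' - 1 := by
          have := h.symm.sub_one_mul_conj
          field_simp; linarith
        calc s' * (y ^ s / s + M ^ s / s') = s' / s * y ^ s + M ^ s := by field_simp
          _ = _ := by rw [this]
      rw [e]
      nlinarith [mul_le_mul_of_nonneg_left hyoung h0'.le]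
  have hroot : runMax F [] ^ s - s' * (runMax F [] ^ (s - 1) * F []) ≤ 0 := by
    change F [] ^ s - s' * (F [] ^ (s - 1) * F []) ≤ 0
    rcases (F0 []).eq_or_lt with h00 | h00
    · rw [← h00]; simp [h0.ne']
    · have e : F [] ^ (s - 1) * F [] = F [] ^ s := by
        rw [← Real.rpow_add_one h00.ne']; ring_nf
      rw [e]
      have := h.symm.lt
      nlinarith [Real.rpow_pos_of_pos h00 s]
  have hlow : treeAvg N (fun u => 1 / 2 * runMax F u ^ s + -(s' * C) * F u ^ s) []
      ≤ treeAvg N (fun u => runMax F u ^ s - s' * (runMax F u ^ (s - 1) * F u)) [] := by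
    refine treeAvg_mono fun v _ => ?_
    have := hY (F (v ++ [])) (runMax F (v ++ []) ^ (s - 1)) (F0 _)
      (Real.rpow_nonneg (M0 _) _)
    rw [← Real.rpow_mul (M0 _), hs1] at this
    have h3 := mul_le_mul_of_nonneg_left this h0'.le
    have e : s' * (C * F (v ++ []) ^ s + 1 / (2 * s') * runMax F (v ++ []) ^ s)
      = s' * C * F (v ++ []) ^ s + 1 / 2 * runMax F (v ++ []) ^ s := by field_simp
    rw [e] at h3
    linarith
  rw [treeAvg_add, treeAvg_const_mul, treeAvg_const_mul] at hlow
  linarith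

/-! ### The reverse Hölder inequality -/

/-- The second-order error of `y ^ (1 + δ)` is of order `δ` relative to that of `-log y`. -/
lemma rpow_one_add_le {B y δ : ℝ} (hy : 0 < y) (hyB : y ≤ B) (hδ : 0 < δ) (hδ1 : δ ≤ 1) :
    y ^ (1 + δ) - 1 - (1 + δ) * (y - 1) ≤ δ * (4 * max B 1) * (y - 1 - Real.log y) := by
  have h1 : y ^ δ ≤ 1 + δ * (y - 1) := by
    have := rpow_one_add_le_one_add_mul_self (s := y - 1) (by linarith) hδ.le hδ1
    simpa using this
  have h2 : y ^ (1 + δ) ≤ y * (1 + δ * (y - 1)) := by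
    rw [Real.rpow_add hy, Real.rpow_one]; gcongr
  have h3 : Real.log y ≤ 2 * (√y - 1) := by
    have := Real.log_le_sub_one_of_pos (Real.sqrt_pos.2 hy)
    rw [Real.log_sqrt hy.le] at this
    linarith
  have hs : √y ^ 2 = y := Real.sq_sqrt hy.le
  have hm : √y ^ 2 ≤ max B 1 := hs.le.trans (hyB.trans (le_max_left _ _))
  have hm1 : (1 : ℝ) ≤ max B 1 := le_max_right _ _
  have s0 := Real.sqrt_nonneg y
  have h4 : (√y + 1) ^ 2 ≤ 4 * max B 1 := by nlinarith [sq_nonneg (√y - 1)]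
  have h5 : (y - 1) ^ 2 ≤ 4 * max B 1 * (√y - 1) ^ 2 := by
    have : (y - 1) ^ 2 = (√y + 1) ^ 2 * (√y - 1) ^ 2 := by
      nth_rewrite 1 [← hs]; ring
    rw [this]; gcongr
  have h6 : (√y - 1) ^ 2 ≤ y - 1 - Real.log y := by nlinarith
  have h7 : (y - 1) ^ 2 ≤ 4 * max B 1 * (y - 1 - Real.log y) :=
    h5.trans (by gcongr)
  nlinarith [mul_le_mul_of_nonneg_left h7 hδ.le]

/-- The one-step inequality behind the reverse Hölder inequality: at every point `(w', x')` with
`w' ≤ B w`, the Bellman function `w ^ (1 + δ) * (2 - exp (-2 (log w - x)))` lies below its tangent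
plane at `(w, x)`, provided that `log w - C ≤ x`. -/
lemma rpow_bellman_le {B C δ w w' x x' : ℝ} (hw : 0 < w) (hw' : 0 < w') (hB : w' ≤ B * w)
    (hδ : 0 < δ) (hδ1 : δ ≤ 1)
    (hδC : δ * (8 * max B 1) ≤ (1 - δ) * Real.exp (-(2 * C))) (hx : Real.log w - C ≤ x) :
    w' ^ (1 + δ) * (2 - Real.exp (-(2 * (Real.log w' - x')))) ≤
      w ^ (1 + δ) * (2 - Real.exp (-(2 * (Real.log w - x))) +
        (2 * (1 + δ) + (1 - δ) * Real.exp (-(2 * (Real.log w - x)))) * (w' / w - 1) -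
        2 * Real.exp (-(2 * (Real.log w - x))) * (x' - x)) := by
  obtain ⟨y, rfl⟩ : ∃ y, w' = y * w := ⟨w' / w, by field_simp⟩
  have hy : 0 < y := pos_of_mul_pos_left hw' hw.le
  have hyB : y ≤ B := le_of_mul_le_mul_right hB hw
  set E := Real.exp (-(2 * (Real.log w - x))) with hE
  have hEC : Real.exp (-(2 * C)) ≤ E := Real.exp_le_exp.2 (by linarith)
  have hlog : Real.log (y * w) = Real.log y + Real.log w := Real.log_mul hy.ne' hw.ne'
  have hyE : y ^ (1 + δ) * Real.exp (-(2 * (Real.log (y * w) - x')))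
      = E * Real.exp (2 * (x' - x) - (1 - δ) * Real.log y) := by
    rw [hlog, hE, ← Real.exp_add, Real.rpow_def_of_pos hy, ← Real.exp_add]
    ring_nf
  -- the subtracted term is the exponential of a convex function, so the tangent bound for `exp`
  -- gains the term `y - 1 - log y`, which absorbs the convexity of `y ^ (1 + δ)`
  have hexp : E * (1 + (2 * (x' - x) - (1 - δ) * Real.log y))
      ≤ E * Real.exp (2 * (x' - x) - (1 - δ) * Real.log y) := by
    have := Real.add_one_le_exp (2 * (x' - x) - (1 - δ) * Real.log y)
    gcongr; linarith
  have hpow := rpow_one_add_le hy hyB hδ hδ1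
  have hl : 0 ≤ y - 1 - Real.log y := by
    have := Real.log_le_sub_one_of_pos hy; linarith
  have hcoef : (δ * (8 * max B 1)) * (y - 1 - Real.log y) ≤
      ((1 - δ) * E) * (y - 1 - Real.log y) := by
    refine mul_le_mul_of_nonneg_right ?_ hl
    exact hδC.trans (mul_le_mul_of_nonneg_left hEC (by linarith))
  rw [Real.mul_rpow hy.le hw.le, mul_comm (y ^ (1 + δ)), mul_assoc, mul_sub (y ^ (1 + δ)), hyE]
  refine mul_le_mul_of_nonneg_left ?_ (by positivity)
  rw [mul_div_assoc, div_self hw.ne', mul_one]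
  nlinarith

/-- Reverse Hölder inequality, for a positive martingale `w` whose logarithm exceeds the martingale
`x` by at most `C`. The Bellman function of `(w, x)` is a supermartingale between `w ^ (1 + δ)` and
`2 * w ^ (1 + δ)`. -/
lemma exists_reverse_holder (B C : ℝ) : ∃ δ : ℝ, 0 < δ ∧
    ∀ (σ : Type) [Fintype σ] [Nonempty σ], (Fintype.card σ : ℝ) = B →
      ∀ (N : ℕ) (w x : List σ → ℝ), IsTreeMart N w → IsTreeMart N x → (∀ l, 0 < w l) →
      (∀ l, Real.log (w l) - C ≤ x l) → (∀ l, x l ≤ Real.log (w l)) →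
      treeAvg N (fun l => w l ^ (1 + δ)) [] ≤ 2 * w [] ^ (1 + δ) := by
  have hm : (1 : ℝ) ≤ max B 1 := le_max_right _ _
  set e := Real.exp (-(2 * C))
  have he : 0 < e := Real.exp_pos _
  have hden : 0 < 8 * max B 1 + e := by positivity
  refine ⟨e / (8 * max B 1 + e), by positivity, fun σ _ _ hB N w x hw hx w0 hxl hxu => ?_⟩
  set δ := e / (8 * max B 1 + e) with hδ
  have hδ0 : 0 < δ := by positivity
  have hδ1 : δ ≤ 1 := (div_le_one hden).2 (by linarith)
  have hδC : δ * (8 * max B 1) ≤ (1 - δ) * e := by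
    have : δ * (8 * max B 1 + e) = e := div_mul_cancel₀ _ hden.ne'
    linarith
  set X : List σ → ℝ := fun l =>
    w l ^ (1 + δ) * (2 - Real.exp (-(2 * (Real.log (w l) - x l)))) with hX
  have hsup : treeAvg N X [] ≤ X [] := by
    refine treeAvg_le_of_supermart fun v hv => ?_
    simp only [List.append_nil]
    set E := Real.exp (-(2 * (Real.log (w v) - x v))) with hE
    refine (childAvg_mono fun c => rpow_bellman_le (w0 v) (w0 (c :: v)) ?_ hδ0 hδ1 hδC
      (hxl v)).trans (le_of_eq (?_ : childAvg (fun u => w v ^ (1 + δ) * (2 - E +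
        (2 * (1 + δ) + (1 - δ) * E) * (w u / w v - 1) - 2 * E * (x u - x v))) v = _))
    · rw [← hB, ← hw v hv]
      exact le_card_mul_childAvg (fun c => (w0 _).le) c
    · rw [childAvg_const_mul, childAvg_sub, childAvg_add, childAvg_const_mul, childAvg_const_mul,
        childAvg_sub (fun _ => (2 : ℝ)), childAvg_sub x, childAvg_sub (fun u => w u / w v),
        childAvg_div_const, childAvg_const, childAvg_const, childAvg_const, childAvg_const,
        hw v hv, hx v hv, div_self (w0 v).ne']
      simp only [sub_self, mul_zero, add_zero, sub_zero, hX, hE]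
  calc treeAvg N (fun l => w l ^ (1 + δ)) [] ≤ treeAvg N X [] := by
        refine treeAvg_mono fun v _ => ?_
        have : Real.exp (-(2 * (Real.log (w (v ++ [])) - x (v ++ [])))) ≤ 1 :=
          Real.exp_le_one_iff.2 (by have := hxu (v ++ []); linarith)
        have h0 : 0 ≤ w (v ++ []) ^ (1 + δ) := (Real.rpow_pos_of_pos (w0 _) _).le
        simp only [hX]
        nlinarith
    _ ≤ X [] := hsup
    _ ≤ 2 * w [] ^ (1 + δ) := by
        have h0 : 0 ≤ w [] ^ (1 + δ) := (Real.rpow_pos_of_pos (w0 _) _).le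
        have := Real.exp_pos (-(2 * (Real.log (w []) - x [])))
        simp only [hX]
        nlinarith

end Tree

end MatrixWeight

namespace MatrixWeight

/-! ### Stopping nodes -/

section Path

variable {σ : Type*}

/-- The node, or one of its ancestors other than the root, has the property `bad`. -/
def Stopped (bad : List σ → Prop) : List σ → Prop
  | [] => False
  | c :: l => Stopped bad l ∨ bad (c :: l)

lemma pathSum_append (a : List σ → ℝ) (v l : List σ) :
    pathSum a (v ++ l) = pathSum a l + pathSum (fun u => a (u ++ l)) v := by
  induction v with
  | nil => simp [pathSum]
  | cons c v ih => simp [pathSum, ih, add_assoc]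

lemma pathSum_nonneg {a : List σ → ℝ} (ha : ∀ l, 0 ≤ a l) (l : List σ) : 0 ≤ pathSum a l := by
  induction l with
  | nil => exact le_rfl
  | cons c l ih => exact add_nonneg ih (ha l)

lemma Stopped.append {bad : List σ → Prop} {l : List σ} (h : Stopped bad l) (v : List σ) :
    Stopped bad (v ++ l) := by
  induction v with
  | nil => exact h
  | cons c v ih => exact Or.inl ih

end Path

section Tree

variable {σ : Type*} [Fintype σ] [Nonempty σ]

section Stopping

variable {E : Type*} [NormedAddCommGroup E]

/-- The variance of `h` over the children of a node. -/
noncomputable def childVar (h : List σ → E) (l : List σ) : ℝ :=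
  childAvg (fun u => ‖h u - h l‖ ^ 2) l

omit [Nonempty σ] in
lemma childVar_nonneg (h : List σ → E) (l : List σ) : 0 ≤ childVar h l :=
  childAvg_nonneg fun _ => by positivity

variable [InnerProductSpace ℝ E]

lemma childVar_eq {h : List σ → E} {l : List σ} (hl : childAvg h l = h l) :
    childVar h l = childAvg (fun u => ‖h u‖ ^ 2) l - ‖h l‖ ^ 2 := by
  have e : ∀ u, ‖h u - h l‖ ^ 2 = ‖h u‖ ^ 2 + ‖h l‖ ^ 2 - 2 * innerₗ E (h l) (h u) := fun u => by
    rw [norm_sub_sq_real, real_inner_comm]; simp; ring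
  simp only [childVar, e]
  rw [childAvg_sub, childAvg_add, childAvg_const, childAvg_const_mul, childAvg_map, hl]
  simp only [innerₗ_apply_apply, real_inner_self_eq_norm_sq]
  ring

/-- The stopping condition: the majorant `H` or the weight distortion `ψ` is large, or the square
function of `h` over the proper ancestors is large. -/
def Bad (h : List σ → E) (H ψ : List σ → ℝ) (t c : ℝ) (u : List σ) : Prop :=
  8 * t < H u ∨ 8 * c < ψ u ∨ 8 * (8 * Fintype.card σ * t) ^ 2 < pathSum (childVar h) u

variable {h : List σ → E} {H ψ : List σ → ℝ} {t c : ℝ} {N : ℕ}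

omit [Nonempty σ] [InnerProductSpace ℝ E] in
lemma bounds_of_not_stopped (ht : 0 < t) (hc : 0 < c) (Ht : H [] ≤ t) (ψc : ψ [] ≤ c)
    {u : List σ} (hu : ¬ Stopped (Bad h H ψ t c) u) :
    H u ≤ 8 * t ∧ ψ u ≤ 8 * c ∧
      pathSum (childVar h) u ≤ 8 * (8 * Fintype.card σ * t) ^ 2 := by
  cases u with
  | nil => exact ⟨by linarith, by linarith, by simp only [pathSum]; positivity⟩
  | cons d u =>
    have : ¬ Bad h H ψ t c (d :: u) := fun hb => hu (Or.inr hb)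
    simpa only [Bad, not_or, not_lt] using this

omit [InnerProductSpace ℝ E] in
/-- By regularity, `h` is still controlled one step below a node where `H` is small. -/
lemma norm_child_le (hH : IsTreeMart N H) (H0 : ∀ l, 0 ≤ H l)
    (hhH : ∀ l : List σ, l.length ≤ N → ‖h l‖ ≤ H l) {u : List σ} (huN : u.length < N)
    (hu : H u ≤ 8 * t) (d : σ) : ‖h (d :: u)‖ ≤ 8 * Fintype.card σ * t := by
  refine (hhH _ (by simpa using huN)).trans
    ((le_card_mul_childAvg (fun d => H0 (d :: u)) d).trans ?_)
  rw [hH u huN]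
  have : (0 : ℝ) ≤ Fintype.card σ := by positivity
  nlinarith

lemma childVar_le (hh : IsTreeMart N h) (hH : IsTreeMart N H) (H0 : ∀ l, 0 ≤ H l)
    (hhH : ∀ l : List σ, l.length ≤ N → ‖h l‖ ≤ H l) {u : List σ} (huN : u.length < N)
    (hu : H u ≤ 8 * t) : childVar h u ≤ (8 * Fintype.card σ * t) ^ 2 := by
  rw [childVar_eq (hh u huN)]
  have : childAvg (fun u => ‖h u‖ ^ 2) u ≤ childAvg (fun _ => (8 * Fintype.card σ * t) ^ 2) u :=
    childAvg_mono fun d => by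
      have := norm_child_le hH H0 hhH huN hu d
      gcongr
  rw [childAvg_const] at this
  have := sq_nonneg ‖h u‖
  linarith

open Classical in
/-- At least half of the leaves are never stopped. The normalized sum `Y` of `H`, `ψ` and
`pathSum (childVar h) + R ^ 2 - ‖h‖ ^ 2` is a martingale that is at least `1` at the first bad node,
and at most `3 / 8` at the root. -/
lemma treeAvg_stopped_le (ht : 0 < t) (hc : 0 < c) (hh : IsTreeMart N h) (hH : IsTreeMart N H)
    (hψ : IsTreeMart N ψ) (H0 : ∀ l, 0 ≤ H l) (ψ0 : ∀ l, 0 ≤ ψ l)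
    (hhH : ∀ l : List σ, l.length ≤ N → ‖h l‖ ≤ H l) (Ht : H [] ≤ t) (ψc : ψ [] ≤ c) :
    treeAvg N (fun u => if Stopped (Bad h H ψ t c) u then 1 else 0) [] ≤ 1 / 2 := by
  have hB : (1 : ℝ) ≤ Fintype.card σ := by exact_mod_cast Fintype.card_pos
  set R : ℝ := 8 * Fintype.card σ * t with hR
  have hR8 : 8 * t ≤ R := by rw [hR]; nlinarith
  have hR0 : 0 < R := by linarith
  set Y : List σ → ℝ := fun u => H u / (8 * t) + ψ u / (8 * c) +
    (pathSum (childVar h) u + R ^ 2 - ‖h u‖ ^ 2) / (8 * R ^ 2) with hY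
  -- `Y` frozen at the value `1` from the first bad node on
  set X : List σ → ℝ := fun u => if Stopped (Bad h H ψ t c) u then 1 else Y u with hX
  have Y0 : ∀ u, ‖h u‖ ≤ R → 0 ≤ Y u := fun u hu => by
    have h1 : ‖h u‖ ^ 2 ≤ R ^ 2 := by gcongr
    have h2 := pathSum_nonneg (childVar_nonneg h) u
    have h3 : 0 ≤ pathSum (childVar h) u + R ^ 2 - ‖h u‖ ^ 2 := by linarith
    have := H0 u
    have := ψ0 u
    positivity
  have Y1 : ∀ u, ‖h u‖ ≤ R → Bad h H ψ t c u → 1 ≤ Y u := fun u hu hb => by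
    have h1 : ‖h u‖ ^ 2 ≤ R ^ 2 := by gcongr
    have h2 := pathSum_nonneg (childVar_nonneg h) u
    have h3 : 0 ≤ (pathSum (childVar h) u + R ^ 2 - ‖h u‖ ^ 2) / (8 * R ^ 2) :=
      div_nonneg (by linarith) (by positivity)
    have h4 : 0 ≤ H u / (8 * t) := div_nonneg (H0 u) (by positivity)
    have h5 : 0 ≤ ψ u / (8 * c) := div_nonneg (ψ0 u) (by positivity)
    rcases hb with hb | hb | hb
    · have : 1 ≤ H u / (8 * t) := (one_le_div (by positivity)).2 hb.le
      simp only [hY]; linarith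
    · have : 1 ≤ ψ u / (8 * c) := (one_le_div (by positivity)).2 hb.le
      simp only [hY]; linarith
    · have : 1 ≤ (pathSum (childVar h) u + R ^ 2 - ‖h u‖ ^ 2) / (8 * R ^ 2) :=
        (one_le_div (by positivity)).2 (by linarith)
      simp only [hY]; linarith
  have hsup : treeAvg N X [] ≤ X [] := by
    refine treeAvg_le_of_supermart fun u hu => ?_
    simp only [List.append_nil]
    by_cases hs : Stopped (Bad h H ψ t c) u
    · have e : X u = 1 := if_pos hs
      rw [e, ← childAvg_const (σ := σ) (1 : ℝ) u]
      exact childAvg_mono fun d => (if_pos (Or.inl hs)).le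
    · have hb := bounds_of_not_stopped ht hc Ht ψc hs
      have e : X u = Y u := if_neg hs
      have hstep : ∀ d, X (d :: u) ≤ H (d :: u) / (8 * t) + ψ (d :: u) / (8 * c) +
          (pathSum (childVar h) u + childVar h u + R ^ 2 - ‖h (d :: u)‖ ^ 2) / (8 * R ^ 2) := by
        intro d
        change X (d :: u) ≤ Y (d :: u)
        by_cases hd : Stopped (Bad h H ψ t c) (d :: u)
        · simp only [hX, if_pos hd]
          refine Y1 _ (norm_child_le hH H0 hhH hu hb.1 d) (hd.resolve_left hs)
        · simp only [hX, if_neg hd, le_refl]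
      refine (childAvg_mono (G := fun v => H v / (8 * t) + ψ v / (8 * c) +
        (pathSum (childVar h) u + childVar h u + R ^ 2 - ‖h v‖ ^ 2) / (8 * R ^ 2)) hstep).trans
        (le_of_eq ?_)
      rw [childAvg_add, childAvg_add (fun v => H v / (8 * t)), childAvg_div_const,
        childAvg_div_const, childAvg_div_const, childAvg_sub (fun _ => _), childAvg_const, hH u hu,
        hψ u hu, childVar_eq (hh u hu), e]
      simp only [hY]
      ring
  have hroot : X [] ≤ 1 / 2 := by
    have e : X [] = Y [] := if_neg (fun h => h)
    rw [e]
    have h1 : H [] / (8 * t) ≤ 1 / 8 := by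
      rw [div_le_div_iff₀ (by positivity) (by positivity)]; linarith
    have h2 : ψ [] / (8 * c) ≤ 1 / 8 := by
      rw [div_le_div_iff₀ (by positivity) (by positivity)]; linarith
    have h3 : (pathSum (childVar h) [] + R ^ 2 - ‖h []‖ ^ 2) / (8 * R ^ 2) ≤ 1 / 8 := by
      rw [div_le_div_iff₀ (by positivity) (by positivity)]
      simp only [pathSum]
      nlinarith [sq_nonneg ‖h []‖]
    simp only [hY]; linarith
  refine (treeAvg_mono fun v hv => ?_).trans (hsup.trans hroot)
  by_cases hs : Stopped (Bad h H ψ t c) (v ++ [])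
  · simp only [hX, if_pos hs, le_refl]
  · simp only [hX, if_neg hs]
    refine Y0 _ ((hhH _ (by simp [hv])).trans ?_)
    exact (bounds_of_not_stopped ht hc Ht ψc hs).1.trans hR8

end Stopping

/-! ### Sparse domination -/

lemma sqrt_add_le_add_sqrt {x y : ℝ} (hx : 0 ≤ x) (hy : 0 ≤ y) : √(x + y) ≤ √x + √y := by
  rw [Real.sqrt_le_iff]
  refine ⟨by positivity, ?_⟩
  nlinarith [Real.sq_sqrt hx, Real.sq_sqrt hy, mul_nonneg (Real.sqrt_nonneg x) (Real.sqrt_nonneg y)]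

open Classical in
/-- Sparse domination of the square function in dual form. Above the stopping nodes below `J` the
square function is controlled by `G J`; the stopping nodes are treated by induction, and the
leaves that are never stopped pay for the term `G J * φ J`. -/
lemma treeAvg_sqrt_pathSum_mul_le {E : Type*} [NormedAddCommGroup E] [InnerProductSpace ℝ E]
    {κ c C₂ C₃ : ℝ} (hκ : 0 ≤ κ) (hc : 0 < c) (hC₂ : 0 ≤ C₂) (hC₃ : 0 < C₃) {N : ℕ}
    {T : List σ → E →ₗ[ℝ] E} {f : List σ → E} {a G φ : List σ → ℝ} {H ψ : List σ → List σ → ℝ}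
    (hf : IsTreeMart N f) (hH : ∀ J, IsTreeMart (N - J.length) (H J))
    (hψ : ∀ J, IsTreeMart (N - J.length) (ψ J))
    (hφ : IsTreeMart N φ) (a0 : ∀ l, 0 ≤ a l) (G0 : ∀ l, 0 < G l) (φ0 : ∀ l, 0 ≤ φ l)
    (H0 : ∀ J l, 0 ≤ H J l) (ψ0 : ∀ J l, 0 ≤ ψ J l)
    (ha : ∀ l, a l ≤ κ * childVar (fun u => T l (f u)) l)
    (hT : ∀ J u x, ‖T (u ++ J) x‖ ≤ C₂ * Real.exp (ψ J u) * ‖T J x‖)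
    (hfH : ∀ J u : List σ, u.length + J.length ≤ N → ‖T J (f (u ++ J))‖ ≤ H J u)
    (HG : ∀ J, J.length ≤ N → H J [] ≤ C₃ * G J) (ψc : ∀ J, ψ J [] ≤ c) (j : ℕ) (J : List σ)
    (hj : j + J.length = N) :
    treeAvg j (fun u => √(pathSum (fun v => a (v ++ J)) u) * φ (u ++ J)) []
      ≤ 2 * (24 * √κ * C₂ * Real.exp (8 * c) * Fintype.card σ * C₃) *
        treeAvg j (fun u => runMax G (u ++ J) * runMax φ (u ++ J)) [] := by
  set C₀ : ℝ := 24 * √κ * C₂ * Real.exp (8 * c) * Fintype.card σ * C₃ with hC₀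
  have hC₀0 : 0 ≤ C₀ := by positivity
  set Z : List σ → ℝ := fun l => runMax G l * runMax φ l with hZ
  induction j using Nat.strong_induction_on generalizing J with
  | _ j IH =>
  have hNJ : N - J.length = j := by omega
  set t : ℝ := C₃ * G J with ht
  have t0 : 0 < t := mul_pos hC₃ (G0 J)
  set h : List σ → E := fun u => T J (f (u ++ J)) with hh
  have hhm : IsTreeMart j h := (hf.append J (by omega)).map (T J)
  have hHJ : IsTreeMart j (H J) := hNJ ▸ hH J
  have hψJ : IsTreeMart j (ψ J) := hNJ ▸ hψ J
  have hhH : ∀ l : List σ, l.length ≤ j → ‖h l‖ ≤ H J l := fun l hl => hfH J l (by omega)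
  have Ht : H J [] ≤ t := HG J (by omega)
  set S : List σ → Prop := Stopped (Bad h (H J) (ψ J) t c) with hS
  set R : ℝ := 8 * Fintype.card σ * t with hR
  set κ' : ℝ := κ * (C₂ * Real.exp (8 * c)) ^ 2 with hκ'
  have hκ'0 : 0 ≤ κ' := by positivity
  have haS : ∀ u, ¬ S u → a (u ++ J) ≤ κ' * childVar h u := fun u hu => by
    refine (ha _).trans ?_
    rw [hκ', mul_assoc]
    refine mul_le_mul_of_nonneg_left ?_ hκ
    rw [childVar, ← childAvg_append, childVar, ← childAvg_const_mul]
    refine childAvg_mono fun d => ?_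
    rw [← mul_pow]
    simp only [hh]
    rw [← map_sub, ← map_sub]
    have h1 := (bounds_of_not_stopped t0 hc Ht (ψc J) hu).2.1
    have h2 := hT J u (f (d :: u ++ J) - f (u ++ J))
    gcongr
    refine h2.trans ?_
    gcongr
  have hpath : ∀ u, ¬ S u → ∀ d, pathSum (fun v => a (v ++ J)) (d :: u) ≤
      κ' * (pathSum (childVar h) u + childVar h u) := by
    intro u
    induction u with
    | nil =>
      intro hu d
      simpa [pathSum] using haS [] hu
    | cons e u ih =>
      intro hu d
      have := ih (fun hs => hu (Or.inl hs)) e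
      have h2 := haS _ hu
      rw [pathSum, pathSum]
      have e3 : pathSum (childVar h) (e :: u) = pathSum (childVar h) u + childVar h u := rfl
      simp only [pathSum] at this
      rw [e3]
      linarith
  have hκR : √(κ' * (9 * R ^ 2)) = C₀ * G J := by
    have : κ' * (9 * R ^ 2) = κ * (3 * (C₂ * Real.exp (8 * c)) * R) ^ 2 := by rw [hκ']; ring
    rw [this, Real.sqrt_mul hκ, Real.sqrt_sq (by positivity), hC₀, hR, ht]
    ring
  have hsqrt : ∀ u, ¬ S u → u.length < j → ∀ d,
      √(pathSum (fun v => a (v ++ J)) (d :: u)) ≤ C₀ * G J := fun u hu huj d => by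
    rw [← hκR]
    refine Real.sqrt_le_sqrt ((hpath u hu d).trans (mul_le_mul_of_nonneg_left ?_ hκ'0))
    have hb := bounds_of_not_stopped t0 hc Ht (ψc J) hu
    have := childVar_le hhm hHJ (H0 J) hhH huj hb.1
    linarith [hb.2.2]
  -- induction towards the root, over the nodes that are not stopped
  have claim : ∀ i u, i + u.length = j → ¬ S u →
      treeAvg i (fun u => √(pathSum (fun v => a (v ++ J)) u) * φ (u ++ J)) u ≤
        C₀ * G J * φ (u ++ J) +
        2 * C₀ * treeAvg i (fun u => if S u then Z (u ++ J) else 0) u := by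
    intro i
    induction i with
    | zero =>
      intro u hu hs
      simp only [treeAvg_zero, if_neg hs, mul_zero, add_zero]
      refine mul_le_mul_of_nonneg_right ?_ (φ0 _)
      cases u with
      | nil => simpa [pathSum] using mul_nonneg hC₀0 (G0 J).le
      | cons d u => exact hsqrt u (fun hs' => hs (Or.inl hs')) (by simp at hu; omega) d
    | succ i ih =>
      intro u hu hs
      rw [treeAvg_succ, treeAvg_succ, ← hφ (u ++ J) (by simp; omega), ← childAvg_append φ,
        ← childAvg_const_mul, ← childAvg_const_mul, ← childAvg_add]
      refine childAvg_mono fun d => ?_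
      by_cases hd : S (d :: u)
      -- at the first bad node the outer induction hypothesis takes over
      · have hIH := IH i (by omega) (d :: u ++ J) (by simp; omega)
        have e1 : treeAvg i (fun u => if S u then Z (u ++ J) else 0) (d :: u)
            = treeAvg i (fun v => Z (v ++ (d :: u ++ J))) [] := by
          rw [← List.nil_append (d :: u), ← treeAvg_append]
          refine treeAvg_congr fun v _ => ?_
          rw [if_pos (hd.append _)]
          simp
        rw [e1]
        refine le_trans ?_ (add_le_add_right hIH _)
        rw [← List.nil_append (d :: u), ← treeAvg_append]
        have e2 : C₀ * G J * φ ([] ++ (d :: u) ++ J)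
            = treeAvg i (fun v => C₀ * G J * φ (v ++ (d :: u ++ J))) [] := by
          rw [treeAvg_const_mul, treeAvg_append, hφ.treeAvg_eq (by simp; omega)]
          simp
        rw [e2, ← treeAvg_add]
        refine treeAvg_mono fun v _ => ?_
        simp only [List.append_nil, List.nil_append]
        rw [← List.append_assoc v, ← add_mul]
        refine mul_le_mul_of_nonneg_right ?_ (φ0 _)
        rw [pathSum_append]
        refine (sqrt_add_le_add_sqrt (pathSum_nonneg (fun _ => a0 _) _)
          (pathSum_nonneg (fun _ => a0 _) _)).trans (add_le_add (hsqrt u hs (by omega) d) ?_)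
        simp
      · exact ih (d :: u) (by simp; omega) hd
  have h1 := claim j [] (by simp) (fun hs => hs)
  refine h1.trans ?_
  have hφJ : treeAvg j (fun u => φ (u ++ J)) [] = φ J := by
    rw [treeAvg_append, hφ.treeAvg_eq (by simp; omega), List.nil_append]
  have hhalf := treeAvg_stopped_le t0 hc hhm hHJ hψJ (H0 J) (ψ0 J) hhH Ht (ψc J)
  -- the leaves that are not stopped
  have h2 : treeAvg j (fun u => G J * φ J * (1 + -1 * (if S u then (1 : ℝ) else 0)) +
      if S u then Z (u ++ J) else 0) [] ≤ treeAvg j (fun u => Z (u ++ J)) [] := by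
    refine treeAvg_mono fun v _ => ?_
    by_cases hv : S (v ++ [])
    · simp only [if_pos hv]; linarith
    · simp only [if_neg hv, mul_zero, add_zero, mul_one]
      exact mul_le_mul (le_runMax_append G _ J) (le_runMax_append φ _ J) (φ0 J)
        (runMax_nonneg (fun l => (G0 l).le) _)
  rw [treeAvg_add, treeAvg_const_mul, treeAvg_add, treeAvg_const, treeAvg_const_mul] at h2
  have hGφ : 0 ≤ G J * φ J := mul_nonneg (G0 J).le (φ0 J)
  have h3 : G J * φ J * (1 / 2) ≤ G J * φ J *
      (1 + -1 * treeAvg j (fun u => if S u then (1 : ℝ) else 0) []) := by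
    refine mul_le_mul_of_nonneg_left ?_ hGφ
    linarith
  have h4 := mul_le_mul_of_nonneg_left (add_le_add_left h3
    (treeAvg j (fun u => if S u then Z (u ++ J) else 0) [])) hC₀0
  have h5 := mul_le_mul_of_nonneg_left h2 hC₀0
  simp only [List.nil_append]
  nlinarith

end Tree

end MatrixWeight

namespace MatrixWeight

/-! ### The square function estimate on the tree -/

/-- The square function estimate for the tree. The martingales `w J i` and `x J i`, defined below
the node `J`, play the role of the averages of `|W^{1/p} V_J⁻¹ e_i| ^ p` and of its logarithm, `γ`
that of the averages of `|W^{-1/p} f| ^ p'`, and `T J` is multiplication by `V_J⁻¹`. -/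
lemma exists_treeAvg_pathSum_rpow_le {p p' : ℝ} (hp : p.HolderConjugate p') (n : ℕ)
    {B κ c C₂ Cw A : ℝ} (hκ : 0 ≤ κ) (hc : 0 < c) (hC₂ : 0 ≤ C₂) (hA : 0 ≤ A) :
    ∃ C : ℝ, 0 ≤ C ∧ ∀ (σ : Type) [Fintype σ] [Nonempty σ], (Fintype.card σ : ℝ) = B →
      ∀ (E : Type) [NormedAddCommGroup E] [InnerProductSpace ℝ E] (N : ℕ)
        (T : List σ → E →ₗ[ℝ] E) (f : List σ → E) (a γ : List σ → ℝ)
        (w x : List σ → Fin n → List σ → ℝ) (ψ : List σ → List σ → ℝ),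
      IsTreeMart N f → IsTreeMart N γ → (∀ J i, IsTreeMart N (w J i)) →
      (∀ J i, IsTreeMart N (x J i)) → (∀ J, IsTreeMart N (ψ J)) →
      (∀ l, 0 ≤ a l) → (∀ l, 0 < γ l) → (∀ J i l, 0 < w J i l) → (∀ J l, 0 ≤ ψ J l) →
      (∀ J i l, Real.log (w J i l) - Cw ≤ x J i l) → (∀ J i l, x J i l ≤ Real.log (w J i l)) →
      (∀ J i, w J i [] ≤ A) → (∀ J, ψ J [] ≤ c) →
      (∀ J u, ‖T J (f (u ++ J))‖ ≤ ∑ i, w J i u ^ (1 / p) * γ (u ++ J) ^ (1 / p')) →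
      (∀ J u y, ‖T (u ++ J) y‖ ≤ C₂ * Real.exp (ψ J u) * ‖T J y‖) →
      (∀ l, a l ≤ κ * childVar (fun u => T l (f u)) l) →
      treeAvg N (fun u => √(pathSum a u) ^ p') [] ≤ C * γ [] := by
  obtain ⟨δ, hδ, hRH⟩ := exists_reverse_holder B Cw
  have p0 := hp.pos
  have p1 := hp.lt
  have p0' := hp.symm.pos
  -- the reverse Hölder inequality improves the exponent `p` to `q`, so that `q' < p'`
  set q := p * (1 + δ) with hq
  have q1 : 1 < q := by nlinarith
  have q0 : 0 < q := by linarith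
  obtain ⟨q', hqq⟩ : ∃ q', q.HolderConjugate q' := ⟨_, Real.HolderConjugate.conjExponent q1⟩
  have q0' := hqq.symm.pos
  have hqp : q' < p' := by
    have h1 := hqq.inv_add_inv_eq_one
    have h2 := hp.inv_add_inv_eq_one
    have h3 : q⁻¹ < p⁻¹ := inv_strictAnti₀ p0 (by nlinarith)
    exact (inv_lt_inv₀ p0' q0').1 (by linarith)
  set θ := q' / p' with hθ
  have hs1 : 1 < p' / q' := (one_lt_div q0').2 hqp
  obtain ⟨CG, hCG, hDG⟩ := exists_treeAvg_runMax_le (Real.HolderConjugate.conjExponent hs1)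
  obtain ⟨Cφ, hCφ, hDφ⟩ := exists_treeAvg_runMax_le hp
  set C₃ : ℝ := n * (2 * A ^ (1 + δ)) ^ (1 / q) + 1 with hC₃
  have C₃0 : 0 < C₃ := by positivity
  set D : ℝ := 2 * (24 * √κ * C₂ * Real.exp (8 * c) * |B| * C₃) with hD
  have hD0 : 0 ≤ D := by positivity
  -- `ε` is such that the term containing the maximal function of `φ` can be absorbed
  obtain ⟨CY, hCY, hY⟩ := exists_young hp.symm (ε := 1 / (2 * (D + 1) * Cφ)) (by positivity)
  refine ⟨2 * (D * (CY * CG)), by positivity, ?_⟩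
  intro σ _ _ hB E _ _ N T f a γ w x ψ hf hγ hw hx hψ a0 γ0 w0 ψ0 hxl hxu hwA hψc hfw hT ha
  set b : List σ → ℝ := fun u => √(pathSum a u) with hb
  have b0 : ∀ u, 0 ≤ b u := fun u => Real.sqrt_nonneg _
  set Γ : List σ → ℝ := fun l => treeAvg (N - l.length) (fun u => γ u ^ θ) l with hΓ
  have hΓm : IsTreeMart N Γ := isTreeMart_treeAvg N _
  have Γ1 : ∀ l, 0 < Γ l := fun l =>
    treeAvg_pos fun v _ => Real.rpow_pos_of_pos (γ0 _) _
  set G : List σ → ℝ := fun l => Γ l ^ (1 / q') with hG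
  set H : List σ → List σ → ℝ := fun J u => treeAvg (N - J.length - u.length)
    (fun v => ∑ i, w J i v ^ (1 / p) * γ (v ++ J) ^ (1 / p')) u with hH
  -- the test function that is dual to `b` in `L ^ p'`
  set φ : List σ → ℝ := fun l => treeAvg (N - l.length) (fun u => b u ^ (p' - 1)) l with hφ
  have φ0 : ∀ l, 0 ≤ φ l := fun l => treeAvg_nonneg fun v _ => Real.rpow_nonneg (b0 _) _
  have hφm : IsTreeMart N φ := isTreeMart_treeAvg N _
  have term0 : ∀ J i v, 0 < w J i v ^ (1 / p) * γ (v ++ J) ^ (1 / p') := fun J i v =>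
    mul_pos (Real.rpow_pos_of_pos (w0 J i v) _) (Real.rpow_pos_of_pos (γ0 _) _)
  have hHG : ∀ J : List σ, J.length ≤ N → H J [] ≤ C₃ * G J := by
    intro J _
    have e : H J [] = ∑ i, treeAvg (N - J.length)
        (fun v => w J i v ^ (1 / p) * γ (v ++ J) ^ (1 / p')) [] := by
      simp only [hH, List.length_nil, Nat.sub_zero]
      exact treeAvg_sum _ _ _ _
    rw [e]
    have hi : ∀ i : Fin n, treeAvg (N - J.length)
        (fun v => w J i v ^ (1 / p) * γ (v ++ J) ^ (1 / p')) []
          ≤ (2 * A ^ (1 + δ)) ^ (1 / q) * G J := by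
      intro i
      refine (treeAvg_mul_le_of_pos hqq (fun v _ => Real.rpow_pos_of_pos (w0 J i _) _)
        (fun v _ => Real.rpow_pos_of_pos (γ0 _) _)).trans ?_
      have e1 : treeAvg (N - J.length) (fun u => (w J i u ^ (1 / p)) ^ q) []
          = treeAvg (N - J.length) (fun u => w J i u ^ (1 + δ)) [] := by
        refine treeAvg_congr fun v _ => ?_
        rw [← Real.rpow_mul (w0 J i _).le]
        congr 1
        rw [hq]; field_simp
      have e2 : treeAvg (N - J.length) (fun u => (γ (u ++ J) ^ (1 / p')) ^ q') [] = Γ J := by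
        have : ∀ u, (γ (u ++ J) ^ (1 / p')) ^ q' = γ (u ++ J) ^ θ := fun u => by
          rw [← Real.rpow_mul (γ0 _).le, hθ]
          congr 1
          field_simp
        simp only [this]
        rw [treeAvg_append (F := fun u => γ u ^ θ), List.nil_append]
      rw [e1, e2]
      refine mul_le_mul_of_nonneg_right (Real.rpow_le_rpow (treeAvg_nonneg fun v _ =>
        (Real.rpow_pos_of_pos (w0 J i _) _).le) ?_ (by positivity))
        (Real.rpow_pos_of_pos (Γ1 J) _).le
      refine (hRH σ hB (N - J.length) (w J i) (x J i) ((hw J i).mono (by omega))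
        ((hx J i).mono (by omega)) (w0 J i) (hxl J i) (hxu J i)).trans ?_
      have := (w0 J i []).le
      have := hwA J i
      gcongr
    refine (Finset.sum_le_sum fun i _ => hi i).trans ?_
    rw [Finset.sum_const, Finset.card_univ, Fintype.card_fin, nsmul_eq_mul, ← mul_assoc, hC₃]
    have := (Real.rpow_pos_of_pos (Γ1 J) (1 / q')).le
    simp only [hG]
    linarith
  have hfH : ∀ J u : List σ, u.length + J.length ≤ N → ‖T J (f (u ++ J))‖ ≤ H J u := by
    intro J u hu
    have hm : IsTreeMart (N - J.length) (fun v => T J (f (v ++ J))) :=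
      (hf.append J (by omega)).map (T J)
    refine (hm.norm_le_treeAvg (j := N - J.length - u.length) (by omega)).trans ?_
    exact treeAvg_mono fun v _ => hfw J _
  have hmain := treeAvg_sqrt_pathSum_mul_le (σ := σ) hκ hc hC₂ C₃0 (T := T) (a := a)
    (G := G) (φ := φ) (H := H) (ψ := ψ) hf (fun J => isTreeMart_treeAvg _ _)
    (fun J => (hψ J).mono (by omega)) hφm a0 (fun l => Real.rpow_pos_of_pos (Γ1 l) _) φ0
    (fun J l => treeAvg_nonneg fun v _ => Finset.sum_nonneg fun i _ => (term0 J i _).le)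
    ψ0 ha hT hfH hHG hψc N [] (by simp)
  simp only [List.append_nil] at hmain
  have hDB : 2 * (24 * √κ * C₂ * Real.exp (8 * c) * Fintype.card σ * C₃) = D := by
    rw [hD, ← hB, abs_of_nonneg (by positivity)]
  rw [hDB] at hmain
  have φleaf : ∀ v : List σ, v.length = N → φ v = b v ^ (p' - 1) := fun v hv => by
    simp only [hφ, hv, Nat.sub_self, treeAvg_zero]
  have p1' := hp.symm.lt
  have eb : treeAvg N (fun u => √(pathSum a u) * φ u) [] = treeAvg N (fun u => b u ^ p') [] := by
    refine treeAvg_congr fun v hv => ?_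
    rw [φleaf _ (by simpa using hv)]
    rcases (b0 (v ++ [])).eq_or_lt with h0 | h0
    · have h0' : √(pathSum a (v ++ [])) = 0 := h0.symm
      rw [← h0, h0', zero_mul, Real.zero_rpow p0'.ne']
    · rw [mul_comm, ← Real.rpow_add_one h0.ne']; ring_nf
  have eφ : treeAvg N (fun u => φ u ^ p) [] = treeAvg N (fun u => b u ^ p') [] := by
    refine treeAvg_congr fun v hv => ?_
    rw [φleaf _ (by simpa using hv), ← Real.rpow_mul (b0 _), hp.symm.sub_one_mul_conj]
  have eG : treeAvg N (fun u => runMax G u ^ p') [] ≤ CG * γ [] := by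
    have e1 : treeAvg N (fun u => runMax G u ^ p') []
        = treeAvg N (fun u => runMax Γ u ^ (p' / q')) [] := by
      refine treeAvg_congr fun v _ => ?_
      rw [hG, runMax_rpow (fun l => (Γ1 l).le) (by positivity),
        ← Real.rpow_mul (runMax_nonneg (fun l => (Γ1 l).le) _), one_div_mul_eq_div]
    have e2 : treeAvg N (fun u => Γ u ^ (p' / q')) [] = γ [] := by
      rw [← hγ.treeAvg_eq (j := N) (l := []) (by simp)]
      refine treeAvg_congr fun v hv => ?_
      have : Γ (v ++ []) = γ (v ++ []) ^ θ := by simp [hΓ, hv]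
      rw [this, ← Real.rpow_mul (γ0 _).le, hθ, div_mul_div_cancel₀ p0'.ne', div_self q0'.ne',
        Real.rpow_one]
    rw [e1, ← e2]
    exact hDG σ N Γ hΓm fun l => (Γ1 l).le
  have hyoung : treeAvg N (fun u => runMax G u * runMax φ u) [] ≤
      CY * treeAvg N (fun u => runMax G u ^ p') [] +
        1 / (2 * (D + 1) * Cφ) * treeAvg N (fun u => runMax φ u ^ p) [] := by
    rw [← treeAvg_const_mul, ← treeAvg_const_mul, ← treeAvg_add]
    exact treeAvg_mono fun v _ => hY _ _
      (runMax_nonneg (fun l => (Real.rpow_pos_of_pos (Γ1 l) _).le) _) (runMax_nonneg φ0 _)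
  have hφD := hDφ σ N φ hφm φ0
  rw [eφ] at hφD
  rw [eb] at hmain
  set X := treeAvg N (fun u => b u ^ p') [] with hX
  have X0 : 0 ≤ X := treeAvg_nonneg fun v _ => Real.rpow_nonneg (b0 _) _
  have h1 : D * (1 / (2 * (D + 1) * Cφ) * treeAvg N (fun u => runMax φ u ^ p) []) ≤ 1 / 2 * X := by
    have hM : 0 ≤ treeAvg N (fun u => runMax φ u ^ p) [] :=
      treeAvg_nonneg fun v _ => Real.rpow_nonneg (runMax_nonneg φ0 _) _
    calc D * (1 / (2 * (D + 1) * Cφ) * treeAvg N (fun u => runMax φ u ^ p) [])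
        ≤ (D + 1) * (1 / (2 * (D + 1) * Cφ) * (Cφ * X)) := by
          gcongr
          linarith
      _ = 1 / 2 * X := by field_simp
  have h2 : D * (CY * treeAvg N (fun u => runMax G u ^ p') []) ≤ D * (CY * (CG * γ [])) := by
    gcongr
  have h3 := mul_le_mul_of_nonneg_left hyoung hD0
  rw [mul_add] at h3
  change X ≤ _
  linarith

end MatrixWeight

namespace MatrixWeight

/-! ### The tree of dyadic subcubes -/

section Grid

variable {d : ℕ} (D : DyadicGrid d)

/-- The index of a subcube, of generation `k`, of the `m`-th cube of generation `k + 1`; the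
entry `true` of `c` selects the upper half in that direction. -/
noncomputable def DyadicGrid.childIdx (k : ℤ) (m : Fin d → ℤ) (c : Fin d → Bool) : Fin d → ℤ :=
  fun i => (D.nested k i).choose + 2 * m i + if c i then 1 else 0

lemma DyadicGrid.corner_childIdx (k : ℤ) (m : Fin d → ℤ) (c : Fin d → Bool) (i : Fin d) :
    D.corner k (D.childIdx k m c) i = D.corner (k + 1) m i + if c i then (2 : ℝ) ^ k else 0 := by
  have h := (D.nested k i).choose_spec
  rw [corner, corner, h, childIdx, zpow_add_one₀ (two_ne_zero)]
  split_ifs <;> push_cast <;> ring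

lemma DyadicGrid.mem_cube {k : ℤ} {m : Fin d → ℤ} {x : Fin d → ℝ} :
    x ∈ D.cube k m ↔ ∀ i, D.corner k m i ≤ x i ∧ x i < D.corner k m i + 2 ^ k := by
  simp [cube, MatrixWeight.cube]

lemma DyadicGrid.mem_cube_childIdx {k : ℤ} {m : Fin d → ℤ} {c : Fin d → Bool} {x : Fin d → ℝ} :
    x ∈ D.cube k (D.childIdx k m c) ↔
      x ∈ D.cube (k + 1) m ∧ ∀ i, c i = true ↔ D.corner (k + 1) m i + 2 ^ k ≤ x i := by
  have h2 : (0 : ℝ) < 2 ^ k := by positivity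
  rw [mem_cube, mem_cube, ← forall_and]
  refine forall_congr' fun i => ?_
  rw [D.corner_childIdx, zpow_add_one₀ (two_ne_zero)]
  by_cases hc : c i = true
  · rw [if_pos hc]
    simp only [hc, true_iff]
    constructor
    · rintro ⟨h, h'⟩; exact ⟨⟨by linarith, by linarith⟩, h⟩
    · rintro ⟨⟨h, h'⟩, h''⟩; exact ⟨h'', by linarith⟩
  · rw [if_neg hc]
    simp only [hc, false_iff, not_le, add_zero, Bool.false_eq_true]
    constructor
    · rintro ⟨h, h'⟩; exact ⟨⟨by linarith, by linarith⟩, h'⟩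
    · rintro ⟨⟨h, h'⟩, h''⟩; exact ⟨h, h''⟩

lemma DyadicGrid.measurableSet_cube (k : ℤ) (m : Fin d → ℤ) : MeasurableSet (D.cube k m) :=
  MeasurableSet.univ_pi fun _ => measurableSet_Ico

lemma DyadicGrid.volume_cube (k : ℤ) (m : Fin d → ℤ) :
    volume (D.cube k m) = ENNReal.ofReal (((2 : ℝ) ^ k) ^ d) := by
  rw [cube, MatrixWeight.cube, Real.volume_pi_Ico]
  simp [ENNReal.ofReal_pow (show (0 : ℝ) ≤ 2 ^ k by positivity)]

lemma DyadicGrid.volume_real_cube (k : ℤ) (m : Fin d → ℤ) :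
    volume.real (D.cube k m) = ((2 : ℝ) ^ k) ^ d := by
  rw [Measure.real, volume_cube, ENNReal.toReal_ofReal (by positivity)]

lemma DyadicGrid.iUnion_childIdx (k : ℤ) (m : Fin d → ℤ) :
    ⋃ c, D.cube k (D.childIdx k m c) = D.cube (k + 1) m := by
  ext x
  simp only [Set.mem_iUnion, mem_cube_childIdx]
  constructor
  · rintro ⟨c, h, _⟩; exact h
  · intro h
    exact ⟨fun i => decide (D.corner (k + 1) m i + 2 ^ k ≤ x i), h, by simp⟩

lemma DyadicGrid.pairwise_disjoint_childIdx (k : ℤ) (m : Fin d → ℤ) :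
    Pairwise (Function.onFun Disjoint fun c => D.cube k (D.childIdx k m c)) := by
  intro c c' hcc
  refine Set.disjoint_left.2 fun x hx hx' => hcc ?_
  rw [mem_cube_childIdx] at hx hx'
  funext i
  rw [Bool.eq_iff_iff]
  exact (hx.2 i).trans (hx'.2 i).symm

lemma DyadicGrid.cube_childIdx_subset (k : ℤ) (m : Fin d → ℤ) (c : Fin d → Bool) :
    D.cube k (D.childIdx k m c) ⊆ D.cube (k + 1) m :=
  fun _ hx => (D.mem_cube_childIdx.1 hx).1

lemma DyadicGrid.setIntegral_cube {E : Type*} [NormedAddCommGroup E] [NormedSpace ℝ E]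
    {F : (Fin d → ℝ) → E} {k : ℤ} {m : Fin d → ℤ} (hF : IntegrableOn F (D.cube (k + 1) m)) :
    ∫ x in D.cube (k + 1) m, F x = ∑ c, ∫ x in D.cube k (D.childIdx k m c), F x := by
  rw [← D.iUnion_childIdx, integral_iUnion_fintype (fun c => D.measurableSet_cube _ _)
    (D.pairwise_disjoint_childIdx k m)]
  exact fun c => hF.mono_set (D.cube_childIdx_subset k m c)

lemma DyadicGrid.setLIntegral_cube (F : (Fin d → ℝ) → ℝ≥0∞) (k : ℤ) (m : Fin d → ℤ) :
    ∫⁻ x in D.cube (k + 1) m, F x = ∑ c, ∫⁻ x in D.cube k (D.childIdx k m c), F x := by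
  rw [← D.iUnion_childIdx, lintegral_iUnion (fun c => D.measurableSet_cube _ _)
    (D.pairwise_disjoint_childIdx k m), tsum_fintype]

lemma DyadicGrid.setAverage_cube_eq {E : Type*} [NormedAddCommGroup E] [NormedSpace ℝ E]
    (F : (Fin d → ℝ) → E) (k : ℤ) (m : Fin d → ℤ) :
    ⨍ x in D.cube k m, F x = (((2 : ℝ) ^ k) ^ d)⁻¹ • ∫ x in D.cube k m, F x := by
  rw [setAverage_eq, volume_real_cube]

/-- The index of the node `l` in the tree of dyadic subcubes of the `m`-th cube of
generation `k`. -/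
noncomputable def DyadicGrid.nodeIdx {d : ℕ} (D : DyadicGrid d) (k : ℤ) (m : Fin d → ℤ) :
    List (Fin d → Bool) → Fin d → ℤ
  | [] => m
  | c :: l => D.childIdx (k - (l.length + 1 : ℕ)) (D.nodeIdx k m l) c

/-- The cube at the node `l`; its generation is `k - l.length`. -/
noncomputable def DyadicGrid.nodeCube (k : ℤ) (m : Fin d → ℤ) (l : List (Fin d → Bool)) :
    Set (Fin d → ℝ) :=
  D.cube (k - l.length) (D.nodeIdx k m l)

/-- The average of a function over the cube at a node. -/
noncomputable def DyadicGrid.nodeAvg {E : Type*} [NormedAddCommGroup E] [NormedSpace ℝ E]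
    (k : ℤ) (m : Fin d → ℤ) (F : (Fin d → ℝ) → E) (l : List (Fin d → Bool)) : E :=
  ⨍ x in D.nodeCube k m l, F x

lemma DyadicGrid.nodeCube_eq (k : ℤ) (m : Fin d → ℤ) (l : List (Fin d → Bool)) :
    D.nodeCube k m l = D.cube ((k - (l.length + 1 : ℕ)) + 1) (D.nodeIdx k m l) := by
  rw [nodeCube]; congr 1; push_cast; ring

lemma DyadicGrid.nodeCube_cons (k : ℤ) (m : Fin d → ℤ) (c : Fin d → Bool)
    (l : List (Fin d → Bool)) : D.nodeCube k m (c :: l) =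
      D.cube (k - (l.length + 1 : ℕ)) (D.childIdx (k - (l.length + 1 : ℕ)) (D.nodeIdx k m l) c) :=
  rfl

lemma DyadicGrid.nodeCube_append_subset (k : ℤ) (m : Fin d → ℤ) (v l : List (Fin d → Bool)) :
    D.nodeCube k m (v ++ l) ⊆ D.nodeCube k m l := by
  induction v with
  | nil => exact subset_rfl
  | cons c v ih =>
    refine subset_trans ?_ ih
    rw [D.nodeCube_eq k m (v ++ l), List.cons_append, D.nodeCube_cons]
    exact D.cube_childIdx_subset _ _ _

/-- The averages of an integrable function form a martingale. -/
lemma DyadicGrid.isTreeMart_nodeAvg {E : Type*} [NormedAddCommGroup E] [NormedSpace ℝ E]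
    {k : ℤ} {m : Fin d → ℤ} {F : (Fin d → ℝ) → E} (hF : IntegrableOn F (D.cube k m)) (N : ℕ) :
    IsTreeMart N (D.nodeAvg k m F) := by
  intro l _
  have hl : IntegrableOn F (D.nodeCube k m l) := by
    refine hF.mono_set ?_
    have := D.nodeCube_append_subset k m l []
    simpa [nodeCube, nodeIdx] using this
  rw [D.nodeCube_eq] at hl
  simp only [childAvg, nodeAvg]
  rw [D.nodeCube_eq, D.setAverage_cube_eq, D.setIntegral_cube hl]
  simp only [D.nodeCube_cons, D.setAverage_cube_eq]
  rw [← Finset.smul_sum, smul_smul]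
  congr 1
  rw [zpow_add_one₀ two_ne_zero, mul_pow]
  simp [mul_comm]

/-- The integral of a function that is constant on the cubes `j` generations below the node `l`. -/
lemma DyadicGrid.setLIntegral_nodeCube {k : ℤ} {m : Fin d → ℤ} {Φ : (Fin d → ℝ) → ℝ≥0∞}
    {F : List (Fin d → Bool) → ℝ} (hF : ∀ l, 0 ≤ F l) {j : ℕ} {l : List (Fin d → Bool)}
    (h : ∀ v : List (Fin d → Bool), v.length = j →
      ∀ x ∈ D.nodeCube k m (v ++ l), Φ x = ENNReal.ofReal (F (v ++ l))) :
    ∫⁻ x in D.nodeCube k m l, Φ x =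
      volume (D.nodeCube k m l) * ENNReal.ofReal (treeAvg j F l) := by
  induction j generalizing l with
  | zero =>
    have h0 : ∀ x ∈ D.nodeCube k m l, Φ x = ENNReal.ofReal (F l) := h [] rfl
    rw [setLIntegral_congr_fun (s := D.nodeCube k m l) (D.measurableSet_cube _ _) h0,
      setLIntegral_const, mul_comm]
    rfl
  | succ j ih =>
    rw [D.nodeCube_eq, D.setLIntegral_cube]
    have h1 : ∀ c, ∫⁻ x in D.cube (k - (l.length + 1 : ℕ))
        (D.childIdx (k - (l.length + 1 : ℕ)) (D.nodeIdx k m l) c), Φ x =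
        ENNReal.ofReal (((2 : ℝ) ^ (k - (l.length + 1 : ℕ))) ^ d) *
          ENNReal.ofReal (treeAvg j F (c :: l)) := by
      intro c
      rw [← D.nodeCube_cons, ih, nodeCube_cons, volume_cube]
      intro v hv x hx
      have := h (v ++ [c]) (by simp [hv]) x (by simpa using hx)
      simpa using this
    simp only [h1]
    rw [← Finset.mul_sum, ← ENNReal.ofReal_sum_of_nonneg
      (fun c _ => treeAvg_nonneg fun v _ => hF _), volume_cube,
      ← ENNReal.ofReal_mul (by positivity), ← ENNReal.ofReal_mul (by positivity), treeAvg_succ,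
      childAvg, zpow_add_one₀ two_ne_zero, mul_pow]
    congr 1
    simp only [Fintype.card_pi, Fintype.card_bool, Finset.prod_const, Finset.card_univ,
      Fintype.card_fin, smul_eq_mul]
    push_cast
    field_simp

/-! ### Haar coefficients -/

/-- The sign of `h_I^ε` on the subcube of `I` selected by `c`. -/
def haarSign (ε c : Fin d → Bool) : ℝ :=
  ∏ i, if ε i then 1 else if c i then -1 else 1

lemma abs_haarSign (ε c : Fin d → Bool) : |haarSign ε c| = 1 := by
  rw [haarSign, Finset.abs_prod]
  refine Finset.prod_eq_one fun i _ => ?_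
  split_ifs <;> simp

lemma sum_haarSign {ε : Fin d → Bool} (hε : ε ∈ signatures d) : ∑ c, haarSign ε c = 0 := by
  obtain ⟨i, hi⟩ : ∃ i, ε i = false := by
    by_contra! h
    refine (Finset.mem_filter.1 hε).2 (funext fun i => ?_)
    simpa using h i
  simp only [haarSign]
  rw [← Fintype.piFinset_univ, ← Finset.prod_univ_sum
    (fun _ => Finset.univ) (fun i (b : Bool) => if ε i then (1 : ℝ) else if b then -1 else 1)]
  exact Finset.prod_eq_zero (Finset.mem_univ i) (by simp [hi])

lemma DyadicGrid.haar_eq_of_mem {k : ℤ} {m : Fin d → ℤ} {ε c : Fin d → Bool} {x : Fin d → ℝ}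
    (hx : x ∈ D.cube k (D.childIdx k m c)) :
    D.haar (k + 1) m ε x = (√((2 : ℝ) ^ (k + 1)))⁻¹ ^ d * haarSign ε c := by
  have h2 : (0 : ℝ) < 2 ^ k := by positivity
  have hx' := D.mem_cube_childIdx.1 hx
  have e : ∀ i, haarOne (ε i) (D.corner (k + 1) m i) (2 ^ (k + 1)) (x i) =
      (√((2 : ℝ) ^ (k + 1)))⁻¹ * if ε i then 1 else if c i then -1 else 1 := by
    intro i
    have h1 := D.mem_cube.1 hx'.1 i
    have h3 := hx'.2 i
    have h4 : (2 : ℝ) ^ (k + 1) / 2 = 2 ^ k := by rw [zpow_add_one₀ two_ne_zero]; ring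
    rw [haarOne, h4]
    congr 1
    by_cases hε : ε i = true
    · simp only [hε, if_true]
      rw [Set.indicator_of_mem (show x i ∈ Set.Ico _ _ from h1)]
    · simp only [hε, Bool.false_eq_true, if_false]
      by_cases hc : c i = true
      · have h5 := h3.1 hc
        rw [Set.indicator_of_notMem (fun h => absurd h.2 (not_lt.2 h5)),
          Set.indicator_of_mem (show x i ∈ Set.Ico _ _ from ⟨h5, h1.2⟩)]
        simp [hc]
      · have h5 : x i < D.corner (k + 1) m i + 2 ^ k := by
          by_contra h; exact hc (h3.2 (not_lt.1 h))
        rw [Set.indicator_of_mem (show x i ∈ Set.Ico _ _ from ⟨h1.1, h5⟩),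
          Set.indicator_of_notMem (fun h => absurd h.1 (not_le.2 h5))]
        simp [hc]
  rw [haar, Finset.prod_congr rfl fun i _ => e i, Finset.prod_mul_distrib, haarSign]
  simp

lemma DyadicGrid.haar_eq_zero {k : ℤ} {m : Fin d → ℤ} {ε : Fin d → Bool} {x : Fin d → ℝ}
    (hx : x ∉ D.cube k m) : D.haar k m ε x = 0 := by
  have h2 : (0 : ℝ) < 2 ^ k := by positivity
  rw [D.mem_cube, not_forall] at hx
  obtain ⟨i, hi⟩ := hx
  refine Finset.prod_eq_zero (Finset.mem_univ i) ?_
  rw [haarOne, Set.indicator_of_notMem (show x i ∉ Set.Ico _ _ from hi),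
    Set.indicator_of_notMem (fun h => hi ⟨h.1, by linarith [h.2]⟩),
    Set.indicator_of_notMem (fun h => hi ⟨by linarith [h.1], h.2⟩)]
  simp

lemma DyadicGrid.haarCoeff_eq {n : ℕ} {f : (Fin d → ℝ) → Vec n} {k : ℤ} {m : Fin d → ℤ}
    (hf : IntegrableOn f (D.cube (k + 1) m)) (ε : Fin d → Bool) :
    D.haarCoeff f (k + 1) m ε = (√((2 : ℝ) ^ (k + 1)))⁻¹ ^ d •
      ∑ c, haarSign ε c • ∫ x in D.cube k (D.childIdx k m c), f x := by
  have hc : ∀ c, Set.EqOn (fun x => D.haar (k + 1) m ε x • f x)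
      (fun x => ((√((2 : ℝ) ^ (k + 1)))⁻¹ ^ d * haarSign ε c) • f x)
      (D.cube k (D.childIdx k m c)) := fun c x hx => by
    simp only [D.haar_eq_of_mem hx]
  rw [haarCoeff, ← setIntegral_eq_integral_of_forall_compl_eq_zero (s := D.cube (k + 1) m)
    fun x hx => by rw [D.haar_eq_zero hx, zero_smul], ← D.iUnion_childIdx,
    integral_iUnion_fintype (fun c => D.measurableSet_cube _ _) (D.pairwise_disjoint_childIdx k m),
    Finset.smul_sum]
  · refine Finset.sum_congr rfl fun c _ => ?_
    rw [setIntegral_congr_fun (D.measurableSet_cube _ _) (hc c), integral_smul, smul_smul]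
  · intro c
    refine IntegrableOn.congr_fun ?_ (hc c).symm (D.measurableSet_cube _ _)
    exact Integrable.smul ((√((2 : ℝ) ^ (k + 1)))⁻¹ ^ d * haarSign ε c)
      (hf.mono_set (D.cube_childIdx_subset k m c))

/-- The Haar coefficients of a cube are controlled by the variance of the averages over its
subcubes. -/
lemma DyadicGrid.sum_haarCoeff_le {n : ℕ} {f : (Fin d → ℝ) → Vec n} {k : ℤ} {m : Fin d → ℤ}
    (hf : IntegrableOn f (D.cube k m)) (T : Vec n →ₗ[ℝ] Vec n) (l : List (Fin d → Bool)) :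
    ∑ ε ∈ signatures d, ‖T (D.haarCoeff f (k - l.length) (D.nodeIdx k m l) ε)‖ ^ 2 /
      ((2 : ℝ) ^ (k - (l.length : ℤ))) ^ d ≤
      2 ^ d * childVar (fun u => T (D.nodeAvg k m f u)) l := by
  have hl : IntegrableOn f (D.nodeCube k m l) := by
    refine hf.mono_set ?_
    have := D.nodeCube_append_subset k m l []
    simpa [nodeCube, nodeIdx] using this
  set k' : ℤ := k - (l.length + 1 : ℕ) with hk'
  have hkk : k - (l.length : ℤ) = k' + 1 := by rw [hk']; push_cast; ring
  rw [nodeCube, hkk] at hl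
  have hcard : (Fintype.card (Fin d → Bool) : ℝ) = 2 ^ d := by simp
  set y : Vec n := T (D.nodeAvg k m f l) with hy
  set z : (Fin d → Bool) → Vec n := fun c => T (D.nodeAvg k m f (c :: l)) with hz
  have hvar : childVar (fun u => T (D.nodeAvg k m f u)) l = (2 ^ d : ℝ)⁻¹ * ∑ c, ‖z c - y‖ ^ 2 := by
    rw [childVar, childAvg, hcard, smul_eq_mul]
  have hε : ∀ ε ∈ signatures d, ‖T (D.haarCoeff f (k - l.length) (D.nodeIdx k m l) ε)‖ ^ 2 /
      ((2 : ℝ) ^ (k - (l.length : ℤ))) ^ d ≤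
        childVar (fun u => T (D.nodeAvg k m f u)) l := by
    intro ε hε
    have h2 : (0 : ℝ) < 2 ^ k' := by positivity
    have h2' : (0 : ℝ) < 2 ^ (k' + 1) := by positivity
    have hint : ∀ c, ∫ x in D.cube k' (D.childIdx k' (D.nodeIdx k m l) c), f x =
        ((2 : ℝ) ^ k') ^ d • D.nodeAvg k m f (c :: l) := fun c => by
      rw [nodeAvg, nodeCube_cons, setAverage_cube_eq, smul_smul, mul_inv_cancel₀ (by positivity),
        one_smul]
    have e1 : T (D.haarCoeff f (k - l.length) (D.nodeIdx k m l) ε) =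
        ((√((2 : ℝ) ^ (k' + 1)))⁻¹ ^ d * ((2 : ℝ) ^ k') ^ d) •
          ∑ c, haarSign ε c • (z c - y) := by
      rw [hkk, D.haarCoeff_eq hl]
      simp only [hint]
      rw [map_smul, map_sum, mul_smul]
      congr 1
      have e3 : ∑ c, haarSign ε c • y = 0 := by rw [← Finset.sum_smul, sum_haarSign hε, zero_smul]
      simp only [smul_sub, Finset.sum_sub_distrib]
      rw [e3, smul_zero, sub_zero, Finset.smul_sum]
      refine Finset.sum_congr rfl fun c _ => ?_
      simp only [map_smul, hz]
      rw [smul_comm]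
    rw [e1, hkk, hvar, norm_smul, mul_pow, Real.norm_of_nonneg (by positivity)]
    have e2 : ((√((2 : ℝ) ^ (k' + 1)))⁻¹ ^ d * ((2 : ℝ) ^ k') ^ d) ^ 2 =
        ((2 : ℝ) ^ (k' + 1)) ^ d * ((2 : ℝ) ^ d)⁻¹ ^ 2 := by
      have h3 : (√((2 : ℝ) ^ (k' + 1)))⁻¹ ^ 2 = ((2 : ℝ) ^ (k' + 1))⁻¹ := by
        rw [inv_pow, Real.sq_sqrt h2'.le]
      have h4 : (2 : ℝ) ^ (k' + 1) = 2 ^ k' * 2 := zpow_add_one₀ two_ne_zero _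
      have h5 : ((√((2 : ℝ) ^ (k' + 1)))⁻¹ ^ d) ^ 2 = (((2 : ℝ) ^ (k' + 1)) ^ d)⁻¹ := by
        rw [← pow_mul, mul_comm d 2, pow_mul, h3, inv_pow]
      rw [mul_pow, h5, h4, mul_pow]
      field_simp
    rw [e2]
    have h6 : ‖∑ c, haarSign ε c • (z c - y)‖ ^ 2 ≤ 2 ^ d * ∑ c, ‖z c - y‖ ^ 2 := by
      have h7 : ‖∑ c, haarSign ε c • (z c - y)‖ ≤ ∑ c, ‖z c - y‖ := by
        refine (norm_sum_le _ _).trans (Finset.sum_le_sum fun c _ => ?_)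
        rw [norm_smul, Real.norm_eq_abs, abs_haarSign, one_mul]
      refine (pow_le_pow_left₀ (norm_nonneg _) h7 2).trans ?_
      have := sq_sum_le_card_mul_sum_sq (s := Finset.univ) (f := fun c => ‖z c - y‖)
      rwa [Finset.card_univ, hcard] at this
    calc ((2 : ℝ) ^ (k' + 1)) ^ d * ((2 : ℝ) ^ d)⁻¹ ^ 2 * ‖∑ c, haarSign ε c • (z c - y)‖ ^ 2 /
          ((2 : ℝ) ^ (k' + 1)) ^ d
        = ((2 : ℝ) ^ d)⁻¹ ^ 2 * ‖∑ c, haarSign ε c • (z c - y)‖ ^ 2 := by field_simp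
      _ ≤ ((2 : ℝ) ^ d)⁻¹ ^ 2 * (2 ^ d * ∑ c, ‖z c - y‖ ^ 2) := by gcongr
      _ = (2 ^ d : ℝ)⁻¹ * ∑ c, ‖z c - y‖ ^ 2 := by field_simp
  refine (Finset.sum_le_card_nsmul _ _ _ hε).trans ?_
  rw [nsmul_eq_mul]
  refine mul_le_mul_of_nonneg_right ?_ (childVar_nonneg _ _)
  rw [← hcard]
  exact_mod_cast Finset.card_le_univ _

end Grid

end MatrixWeight

namespace MatrixWeight

/-! ### Matrix powers -/

section Mat

variable {n : ℕ}

lemma act_add (A : Mat n) (u v : Vec n) : act A (u + v) = act A u + act A v := by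
  simp [act, Matrix.mulVec_add]

lemma act_smul (A : Mat n) (c : ℂ) (v : Vec n) : act A (c • v) = c • act A v := by
  simp [act, Matrix.mulVec_smul]

lemma act_mul (A B : Mat n) (v : Vec n) : act (A * B) v = act A (act B v) := by
  simp [act, Matrix.mulVec_mulVec]

lemma act_one (v : Vec n) : act (1 : Mat n) v = v := by
  simp [act]

/-- The action of a complex matrix as a complex linear map. -/
noncomputable def actLin (A : Mat n) : Vec n →ₗ[ℂ] Vec n where
  toFun := act A
  map_add' := act_add A
  map_smul' := act_smul A

@[simp] lemma actLin_apply (A : Mat n) (v : Vec n) : actLin A v = act A v := rfl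

lemma act_zero (A : Mat n) : act A 0 = 0 := (actLin A).map_zero

lemma inner_act {A : Mat n} (hA : A.IsHermitian) (u v : Vec n) :
    inner ℂ (act A u) v = inner ℂ u (act A v) := by
  have := Matrix.isSymmetric_toEuclideanLin_iff.2 hA u v
  exact this

/-- The norms `|A u|` and `|A⁻¹ v|` are dual to each other. -/
lemma norm_inner_le_of_mul_eq_one {A B : Mat n} (hA : A.IsHermitian) (hAB : A * B = 1)
    (u v : Vec n) : ‖inner ℂ u v‖ ≤ ‖act A u‖ * ‖act B v‖ := by
  have : inner ℂ u v = inner ℂ (act A u) (act B v) := by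
    rw [inner_act hA, ← act_mul, hAB, act_one]
  rw [this]
  exact norm_inner_le_norm _ _

lemma norm_act_pos {A B : Mat n} (hAB : A * B = 1) {v : Vec n} (hv : v ≠ 0) : 0 < ‖act B v‖ := by
  rw [norm_pos_iff]
  intro h
  apply hv
  rw [← act_one v, ← hAB, act_mul, h, act_zero]

lemma spectrum_pos {A : Mat n} (hA : A.PosDef) {t : ℝ} (ht : t ∈ spectrum ℝ A) : 0 < t := by
  rw [hA.1.spectrum_real_eq_range_eigenvalues] at ht
  obtain ⟨i, rfl⟩ := ht
  exact hA.eigenvalues_pos i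

lemma continuousOn_spectrum (A : Mat n) (g : ℝ → ℝ) :
    ContinuousOn g (spectrum ℝ A) :=
  Matrix.finite_real_spectrum.continuousOn g

lemma matPow_isHermitian (A : Mat n) (s : ℝ) : (matPow A s).IsHermitian :=
  cfc_predicate (R := ℝ) (p := IsSelfAdjoint) (fun t : ℝ => t ^ s) A

lemma matPow_mul_matPow_neg {A : Mat n} (hA : A.PosDef) (s : ℝ) :
    matPow A s * matPow A (-s) = 1 := by
  rw [matPow, matPow, ← cfc_mul _ _ A (continuousOn_spectrum A _) (continuousOn_spectrum A _)]
  rw [← cfc_one ℝ A (ha := hA.1)]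
  refine cfc_congr fun t ht => ?_
  have := spectrum_pos hA ht
  simp only [Pi.one_apply]
  rw [← Real.rpow_add this, add_neg_cancel, Real.rpow_zero]

lemma matPow_matPow {A : Mat n} (hA : A.PosDef) (s t : ℝ) :
    matPow (matPow A s) t = matPow A (s * t) := by
  refine (cfc_comp' (fun x : ℝ => x ^ t) (fun x : ℝ => x ^ s) A
    ((Matrix.finite_real_spectrum.image _).continuousOn _) (continuousOn_spectrum A _)
    hA.1).symm.trans (cfc_congr fun x hx => ?_)
  have := spectrum_pos hA hx
  exact (Real.rpow_mul this.le s t).symm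

/-- The `i`-th vector of the standard basis. -/
noncomputable def stdVec (i : Fin n) : Vec n := EuclideanSpace.single i 1

lemma norm_stdVec (i : Fin n) : ‖stdVec i‖ = 1 := by simp [stdVec]

lemma stdVec_ne_zero (i : Fin n) : stdVec i ≠ 0 := by
  rw [← norm_pos_iff, norm_stdVec]; exact one_pos

lemma inner_stdVec (i : Fin n) (v : Vec n) : inner ℂ (stdVec i) v = v i := by
  simp [stdVec, EuclideanSpace.inner_single_left]

lemma sum_smul_stdVec (v : Vec n) : ∑ i, v i • stdVec i = v := by
  have := (EuclideanSpace.basisFun (Fin n) ℂ).sum_repr v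
  simpa [stdVec] using this

lemma norm_le_sum_norm (v : Vec n) : ‖v‖ ≤ ∑ i, ‖v i‖ := by
  nth_rewrite 1 [← sum_smul_stdVec v]
  refine (norm_sum_le _ _).trans (le_of_eq ?_)
  simp [norm_smul, norm_stdVec]

end Mat

/-! ### Jensen's inequality for the logarithm -/

lemma average_log_le {α : Type*} [MeasurableSpace α] {μ : Measure α} [IsFiniteMeasure μ]
    (hμ : μ ≠ 0) {F : α → ℝ} (hF : Integrable F μ)
    (hlog : Integrable (fun x => Real.log (F x)) μ) (h0 : ∀ᵐ x ∂μ, 0 < F x) :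
    (⨍ x, Real.log (F x) ∂μ) ≤ Real.log (⨍ x, F x ∂μ) := by
  have hμr : 0 < μ.real Set.univ := by
    rw [Measure.real, ENNReal.toReal_pos_iff]
    exact ⟨by simpa [pos_iff_ne_zero] using hμ, measure_lt_top _ _⟩
  have hint : 0 < ∫ x, F x ∂μ := by
    rw [integral_pos_iff_support_of_nonneg_ae (h0.mono fun x hx => hx.le) hF]
    have : μ (Function.support F) = μ Set.univ := by
      refine measure_congr ?_
      filter_upwards [h0] with x hx
      have : Function.support F x := hx.ne'
      exact propext ⟨fun _ => trivial, fun _ => this⟩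
    rw [this]
    simpa [pos_iff_ne_zero] using hμ
  set m := ⨍ x, F x ∂μ with hm
  have hm0 : 0 < m := by rw [hm, average_eq, smul_eq_mul]; positivity
  have key : ∫ x, Real.log (F x) ∂μ ≤ ∫ x, (m⁻¹ * F x + (Real.log m - 1)) ∂μ := by
    refine integral_mono_ae hlog ((hF.const_mul _).add (integrable_const _)) ?_
    filter_upwards [h0] with x hx
    have := Real.log_le_sub_one_of_pos (mul_pos (inv_pos.2 hm0) hx)
    rw [Real.log_mul (inv_pos.2 hm0).ne' hx.ne', Real.log_inv] at this
    linarith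
  rw [integral_add (hF.const_mul _) (integrable_const _), integral_const_mul, integral_const,
    smul_eq_mul] at key
  have e : ∫ x, F x ∂μ = μ.real Set.univ * m := by
    rw [hm, average_eq, smul_eq_mul, mul_inv_cancel_left₀ hμr.ne']
  rw [average_eq, smul_eq_mul, inv_mul_le_iff₀ hμr]
  refine key.trans (le_of_eq ?_)
  rw [e]
  field_simp
  ring

end MatrixWeight

namespace MatrixWeight

/-! ### Consequences of the matrix `A_{p,∞}` condition on dyadic cubes -/

section Weight

variable {n d : ℕ} {p K c₁ c₂ : ℝ} {W : (Fin d → ℝ) → Mat n} {D : DyadicGrid d}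
  {V : ℤ → (Fin d → ℤ) → Mat n}

/-- The function `x ↦ |W^{1/p}(x) e|`. -/
noncomputable abbrev rootNorm (p : ℝ) (W : (Fin d → ℝ) → Mat n) (e : Vec n) (x : Fin d → ℝ) : ℝ :=
  ‖act (matPow (W x) (1 / p)) e‖

/-- The function `x ↦ |W^{-1/p}(x) z|`. -/
noncomputable abbrev invRootNorm (p : ℝ) (W : (Fin d → ℝ) → Mat n) (z : Vec n)
    (x : Fin d → ℝ) : ℝ :=
  ‖act (matPow (W x) (-(1 / p))) z‖

lemma ae_norm_inner_le (p : ℝ) (hW : IsMatrixWeight W) :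
    ∀ᵐ x, ∀ u z : Vec n, ‖inner ℂ u z‖ ≤ rootNorm p W u x * invRootNorm p W z x := by
  filter_upwards [hW.posDef] with x hx u z
  exact norm_inner_le_of_mul_eq_one (matPow_isHermitian _ _) (matPow_mul_matPow_neg hx _) u z

lemma ae_rootNorm_pos (p : ℝ) (hW : IsMatrixWeight W) :
    ∀ᵐ x, ∀ e : Vec n, e ≠ 0 → 0 < rootNorm p W e x := by
  filter_upwards [hW.posDef] with x hx e he
  have := matPow_mul_matPow_neg hx (-(1 / p))
  rw [neg_neg] at this
  exact norm_act_pos this he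

lemma ae_invRootNorm_pos (p : ℝ) (hW : IsMatrixWeight W) :
    ∀ᵐ x, ∀ e : Vec n, e ≠ 0 → 0 < invRootNorm p W e x := by
  filter_upwards [hW.posDef] with x hx e he
  exact norm_act_pos (matPow_mul_matPow_neg hx (1 / p)) he

lemma DyadicGrid.volume_cube_ne_top (D : DyadicGrid d) (k : ℤ) (m : Fin d → ℤ) :
    volume (D.cube k m) ≠ ∞ := by
  rw [D.volume_cube]; exact ENNReal.ofReal_ne_top

lemma DyadicGrid.volume_cube_ne_zero (D : DyadicGrid d) (k : ℤ) (m : Fin d → ℤ) :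
    volume (D.cube k m) ≠ 0 := by
  rw [D.volume_cube]; simp; positivity

lemma inv_mul_of_posDef {A : Mat n} (hA : A.PosDef) : A⁻¹ * A = 1 :=
  Matrix.nonsing_inv_mul A ((Matrix.isUnit_iff_isUnit_det A).1 hA.isUnit)

lemma mul_inv_of_posDef {A : Mat n} (hA : A.PosDef) : A * A⁻¹ = 1 :=
  Matrix.mul_nonsing_inv A ((Matrix.isUnit_iff_isUnit_det A).1 hA.isUnit)

lemma act_ne_zero {A : Mat n} (hA : A.PosDef) {e : Vec n} (he : e ≠ 0) : act A e ≠ 0 := by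
  rw [← norm_pos_iff]
  exact norm_act_pos (inv_mul_of_posDef hA) he

lemma act_act_inv {A : Mat n} (hA : A.PosDef) (e : Vec n) : act A (act A⁻¹ e) = e := by
  rw [← act_mul, mul_inv_of_posDef hA, act_one]

lemma act_inv_act {A : Mat n} (hA : A.PosDef) (e : Vec n) : act A⁻¹ (act A e) = e := by
  rw [← act_mul, inv_mul_of_posDef hA, act_one]

section Reducing

variable (hp : 1 < p) (hc₁ : 0 < c₁) (hc₂ : 0 < c₂) (hW : IsMatrixApInftyWith p K W)
  (hV : IsReducingFamily p c₁ c₂ W D V) (k : ℤ) (m : Fin d → ℤ)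

include hc₁ hV in
lemma avgNorm_pos {e : Vec n} (he : e ≠ 0) : 0 < avgNorm p W (D.cube k m) e :=
  (mul_pos hc₁ (norm_pos_iff.2 (act_ne_zero (hV.posDef k m) he))).trans_le (hV.lower k m e)

include hp in
lemma avgNorm_rpow (e : Vec n) :
    avgNorm p W (D.cube k m) e ^ p = ⨍ x in D.cube k m, rootNorm p W e x ^ p := by
  rw [avgNorm, ← Real.rpow_mul, one_div_mul_cancel (by linarith), Real.rpow_one]
  rw [setAverage_eq, smul_eq_mul]
  exact mul_nonneg (by positivity) (integral_nonneg fun x => by positivity)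

include hp hc₁ hV in
/-- The lower bound for the reducing matrices forces `|W^{1/p} e| ^ p` to be integrable. -/
lemma integrableOn_rootNorm (e : Vec n) :
    IntegrableOn (fun x => rootNorm p W e x ^ p) (D.cube k m) := by
  rcases eq_or_ne e 0 with rfl | he
  · have : (fun x => rootNorm p W (0 : Vec n) x ^ p) = fun _ => 0 := by
      funext x
      rw [rootNorm, act_zero, norm_zero, Real.zero_rpow (by linarith)]
    rw [this]; exact integrableOn_zero
  -- otherwise the average is the junk value `0`
  · by_contra h
    have h1 := avgNorm_pos hc₁ hV k m he
    have h2 := avgNorm_rpow (W := W) (D := D) hp k m e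
    rw [setAverage_eq, integral_undef h, smul_zero] at h2
    exact (Real.rpow_pos_of_pos h1 p).ne' h2

include hW in
lemma integrableOn_log_invRootNorm {z : Vec n} (hz : z ≠ 0) :
    IntegrableOn (fun x => Real.log (invRootNorm p W z x)) (D.cube k m) :=
  hW.integrableOn_log _ _ (by positivity) z hz

include hp hc₁ hW hV in
lemma integrableOn_log_rootNorm {e : Vec n} (he : e ≠ 0) :
    IntegrableOn (fun x => Real.log (rootNorm p W e x)) (D.cube k m) := by
  have h1 := integrableOn_rootNorm hp hc₁ hV k m e
  have h2 := integrableOn_log_invRootNorm (D := D) hW k m he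
  have hfin : IntegrableOn (fun _ : Fin d → ℝ => |Real.log (‖e‖ ^ 2)|) (D.cube k m) :=
    integrableOn_const (D.volume_cube_ne_top k m)
  have hpos := ae_restrict_of_ae (s := D.cube k m) (ae_rootNorm_pos p hW.isMatrixWeight)
  have hpos' := ae_restrict_of_ae (s := D.cube k m) (ae_invRootNorm_pos p hW.isMatrixWeight)
  have hin := ae_restrict_of_ae (s := D.cube k m) (ae_norm_inner_le p hW.isMatrixWeight)
  refine Integrable.mono' ((h1.add h2.norm).add hfin) ?_ ?_
  · have : AEStronglyMeasurable (fun x => p⁻¹ * Real.log (rootNorm p W e x ^ p))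
        (volume.restrict (D.cube k m)) :=
      ((Real.measurable_log.comp_aemeasurable h1.aemeasurable).const_mul _).aestronglyMeasurable
    refine this.congr ?_
    filter_upwards [hpos] with x hx
    rw [Real.log_rpow (hx e he), inv_mul_cancel_left₀ (by linarith)]
  · filter_upwards [hpos, hpos', hin] with x hx hx' hi
    have a0 := hx e he
    have b0 := hx' e he
    have e0 : 0 < ‖e‖ := norm_pos_iff.2 he
    have h3 : ‖e‖ ^ 2 ≤ rootNorm p W e x * invRootNorm p W e x := by
      refine le_trans (le_of_eq ?_) (hi e e)
      rw [inner_self_eq_norm_sq_to_K]; simp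
    have h4 := Real.log_le_log (by positivity) h3
    rw [Real.log_mul a0.ne' b0.ne'] at h4
    have h5 : Real.log (rootNorm p W e x) ≤ rootNorm p W e x ^ p := by
      have h6 := Real.log_le_sub_one_of_pos (Real.rpow_pos_of_pos a0 p)
      rw [Real.log_rpow a0] at h6
      have h7 := Real.rpow_pos_of_pos a0 p
      by_contra! h8
      nlinarith
    have h6 : 0 < rootNorm p W e x ^ p := Real.rpow_pos_of_pos a0 p
    simp only [Pi.add_apply, Real.norm_eq_abs]
    rw [abs_le]
    have h7 := neg_abs_le (Real.log (‖e‖ ^ 2))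
    have h8 := le_abs_self (Real.log (invRootNorm p W e x))
    have h9 := abs_nonneg (Real.log (‖e‖ ^ 2))
    have h10 := abs_nonneg (Real.log (invRootNorm p W e x))
    constructor <;> linarith

include hp hc₁ hW hV in
lemma average_log_rootNorm_le {e : Vec n} (he : e ≠ 0) :
    ⨍ x in D.cube k m, p * Real.log (rootNorm p W e x) ≤
      Real.log (⨍ x in D.cube k m, rootNorm p W e x ^ p) := by
  have hpos := ae_restrict_of_ae (s := D.cube k m) (ae_rootNorm_pos p hW.isMatrixWeight)
  have hlog := (integrableOn_log_rootNorm hp hc₁ hW hV k m he).const_mul p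
  have : IsFiniteMeasure (volume.restrict (D.cube k m)) :=
    isFiniteMeasure_restrict.2 (D.volume_cube_ne_top k m)
  have hae : (fun x => p * Real.log (rootNorm p W e x)) =ᵐ[volume.restrict (D.cube k m)]
      fun x => Real.log (rootNorm p W e x ^ p) := by
    filter_upwards [hpos] with x hx
    rw [Real.log_rpow (hx e he)]
  rw [average_congr hae]
  refine average_log_le ?_ (integrableOn_rootNorm hp hc₁ hV k m e) (hlog.congr hae) ?_
  · intro h
    exact D.volume_cube_ne_zero k m (Measure.restrict_eq_zero.1 h)
  · filter_upwards [hpos] with x hx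
    exact Real.rpow_pos_of_pos (hx e he) p

lemma average_const_mul (c : ℝ) (F : (Fin d → ℝ) → ℝ) (s : Set (Fin d → ℝ)) :
    ⨍ x in s, c * F x = c * ⨍ x in s, F x := by
  rw [setAverage_eq, setAverage_eq, integral_const_mul, smul_eq_mul, smul_eq_mul]
  ring

lemma average_add {F G : (Fin d → ℝ) → ℝ} {s : Set (Fin d → ℝ)} (hF : IntegrableOn F s)
    (hG : IntegrableOn G s) : ⨍ x in s, (F x + G x) = (⨍ x in s, F x) + ⨍ x in s, G x := by
  rw [setAverage_eq, setAverage_eq, setAverage_eq, integral_add hF hG, smul_add]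

lemma average_mono {F G : (Fin d → ℝ) → ℝ} {s : Set (Fin d → ℝ)} (hF : IntegrableOn F s)
    (hG : IntegrableOn G s) (h : ∀ᵐ x, F x ≤ G x) : ⨍ x in s, F x ≤ ⨍ x in s, G x := by
  rw [setAverage_eq, setAverage_eq, smul_eq_mul, smul_eq_mul]
  exact mul_le_mul_of_nonneg_left (integral_mono_ae hF hG (ae_restrict_of_ae h)) (by positivity)

lemma average_const (c : ℝ) : ⨍ _ in D.cube k m, c = c := by
  rw [D.setAverage_cube_eq, setIntegral_const, D.volume_real_cube, smul_eq_mul, smul_eq_mul,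
    inv_mul_cancel_left₀ (by positivity)]

include hp hc₁ hW hV in
/-- The geometric means of `|W^{1/p} e|` and `|W^{-1/p} z|` dominate the pairing of `e` and `z`. -/
lemma log_norm_inner_le {e z : Vec n} (hez : inner ℂ e z ≠ 0) :
    Real.log ‖inner ℂ e z‖ ≤ (⨍ x in D.cube k m, Real.log (rootNorm p W e x)) +
      ⨍ x in D.cube k m, Real.log (invRootNorm p W z x) := by
  have he : e ≠ 0 := by rintro rfl; simp at hez
  have hz : z ≠ 0 := by rintro rfl; simp at hez
  have h1 := integrableOn_log_rootNorm hp hc₁ hW hV k m he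
  have h2 := integrableOn_log_invRootNorm (D := D) hW k m hz
  rw [← average_add h1 h2, ← average_const (D := D) k m (Real.log ‖inner ℂ e z‖)]
  refine average_mono (integrableOn_const (D.volume_cube_ne_top k m)) (h1.add h2) ?_
  filter_upwards [ae_rootNorm_pos p hW.isMatrixWeight, ae_invRootNorm_pos p hW.isMatrixWeight,
    ae_norm_inner_le p hW.isMatrixWeight] with x ha hb hi
  rw [← Real.log_mul (ha e he).ne' (hb z hz).ne']
  exact Real.log_le_log (norm_pos_iff.2 hez) (hi e z)

include hp hc₁ hW hV in
lemma average_log_rootNorm_le_log_avgNorm {e : Vec n} (he : e ≠ 0) :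
    ⨍ x in D.cube k m, Real.log (rootNorm p W e x) ≤ Real.log (avgNorm p W (D.cube k m) e) := by
  have h := average_log_rootNorm_le hp hc₁ hW hV k m he
  rw [average_const_mul, ← avgNorm_rpow hp, Real.log_rpow (avgNorm_pos hc₁ hV k m he)] at h
  exact le_of_mul_le_mul_left h (by linarith)

include hc₁ hV in
lemma dualAvgNorm_le (z : Vec n) :
    dualAvgNorm p W (D.cube k m) z ≤ ‖act (V k m)⁻¹ z‖ / c₁ := by
  refine ciSup_le fun u => ?_
  rcases eq_or_ne u 0 with rfl | hu
  · simp only [inner_zero_left, norm_zero, zero_div]; positivity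
  rw [div_le_div_iff₀ (avgNorm_pos hc₁ hV k m hu) hc₁]
  have h1 := norm_inner_le_of_mul_eq_one (hV.posDef k m).1 (mul_inv_of_posDef (hV.posDef k m)) u z
  have h2 := hV.lower k m u
  nlinarith [norm_nonneg (act (V k m)⁻¹ z)]

include hc₁ hW hV in
/-- The matrix `A_{p,∞}` condition, with the dual norm expressed by the reducing matrix. -/
lemma exp_average_log_invRootNorm_le {z : Vec n} (hz : z ≠ 0) :
    Real.exp (⨍ x in D.cube k m, Real.log (invRootNorm p W z x)) ≤
      (|K| + 1) / c₁ * ‖act (V k m)⁻¹ z‖ := by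
  refine (hW.exp_average_log_le _ _ (by positivity) z hz).trans ?_
  have h1 := dualAvgNorm_le hc₁ hV k m z
  have h0 : 0 ≤ dualAvgNorm p W (D.cube k m) z := Real.iSup_nonneg fun u => by
    refine div_nonneg (norm_nonneg _) ?_
    rcases eq_or_ne u 0 with rfl | hu
    · rw [avgNorm]
      refine Real.rpow_nonneg ?_ _
      rw [setAverage_eq, smul_eq_mul]
      exact mul_nonneg (by positivity) (integral_nonneg fun x => by positivity)
    · exact (avgNorm_pos hc₁ hV k m hu).le
  calc K * dualAvgNorm p W (D.cube k m) z ≤ (|K| + 1) * dualAvgNorm p W (D.cube k m) z := by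
        refine mul_le_mul_of_nonneg_right ?_ h0
        linarith [le_abs_self K]
    _ ≤ (|K| + 1) * (‖act (V k m)⁻¹ z‖ / c₁) := by gcongr
    _ = _ := by ring

lemma inv_isHermitian {A : Mat n} (hA : A.PosDef) : (A⁻¹).IsHermitian := hA.1.inv

include hp hc₁ hc₂ hW hV in
/-- The reverse of `exp_average_log_invRootNorm_le`: it holds for every weight, by Jensen's
inequality. -/
lemma norm_act_inv_le {z : Vec n} (hz : z ≠ 0) : ‖act (V k m)⁻¹ z‖ ≤
    c₂ * Real.exp (⨍ x in D.cube k m, Real.log (invRootNorm p W z x)) := by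
  -- the pairing of `z` with `V⁻² z` attains the dual norm
  set A := V k m with hA
  have hApos : A.PosDef := hV.posDef k m
  have hz0 : 0 < ‖act A⁻¹ z‖ :=
    norm_act_pos (mul_inv_of_posDef hApos) hz
  have hin : inner ℂ (act A⁻¹ (act A⁻¹ z)) z = ((‖act A⁻¹ z‖ ^ 2 : ℝ) : ℂ) := by
    rw [inner_act (inv_isHermitian hApos), inner_self_eq_norm_sq_to_K]; simp
  have hne : inner ℂ (act A⁻¹ (act A⁻¹ z)) z ≠ 0 := by
    rw [hin]; exact_mod_cast (pow_pos hz0 2).ne'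
  have he : act A⁻¹ (act A⁻¹ z) ≠ 0 := by
    intro h; rw [h] at hne; simp at hne
  have h1 := log_norm_inner_le hp hc₁ hW hV k m hne
  have h2 := average_log_rootNorm_le_log_avgNorm hp hc₁ hW hV k m he
  have h3 := hV.upper k m (act A⁻¹ (act A⁻¹ z))
  rw [← hA, act_act_inv hApos] at h3
  have h4 := Real.log_le_log (avgNorm_pos hc₁ hV k m he) h3
  rw [hin, Complex.norm_real, Real.norm_of_nonneg (by positivity), Real.log_pow] at h1
  rw [Real.log_mul hc₂.ne' hz0.ne'] at h4
  push_cast at h1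
  rw [← Real.log_le_log_iff hz0 (by positivity), Real.log_mul hc₂.ne' (Real.exp_ne_zero _),
    Real.log_exp]
  linarith

include hp hc₁ hc₂ hW hV in
/-- The weight `|W^{1/p} e| ^ p` satisfies the scalar `A_∞` condition on dyadic cubes. -/
lemma log_average_rootNorm_le {e : Vec n} (he : e ≠ 0) :
    Real.log (⨍ x in D.cube k m, rootNorm p W e x ^ p) - p * Real.log (c₂ * ((|K| + 1) / c₁)) ≤
      ⨍ x in D.cube k m, p * Real.log (rootNorm p W e x) := by
  -- the pairing of `e` with `V² e` attains the norm of `e`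
  set A := V k m with hA
  have hApos : A.PosDef := hV.posDef k m
  have he' := act_ne_zero hApos he
  have he0 : 0 < ‖act A e‖ := norm_pos_iff.2 he'
  have hin : inner ℂ e (act A (act A e)) = ((‖act A e‖ ^ 2 : ℝ) : ℂ) := by
    rw [← inner_act hApos.1, inner_self_eq_norm_sq_to_K]; simp
  have hne : inner ℂ e (act A (act A e)) ≠ 0 := by
    rw [hin]; exact_mod_cast (pow_pos he0 2).ne'
  have hz := act_ne_zero hApos he'
  have h1 := log_norm_inner_le hp hc₁ hW hV k m hne
  have h2 := exp_average_log_invRootNorm_le hc₁ hW hV k m hz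
  rw [← hA, act_inv_act hApos] at h2
  have hK : 0 < (|K| + 1) / c₁ := by positivity
  have h3 := Real.log_le_log (Real.exp_pos _) h2
  rw [Real.log_exp, Real.log_mul hK.ne' he0.ne'] at h3
  have h4 := Real.log_le_log (avgNorm_pos hc₁ hV k m he) (hV.upper k m e)
  rw [← hA, Real.log_mul hc₂.ne' he0.ne'] at h4
  rw [hin, Complex.norm_real, Real.norm_of_nonneg (by positivity), Real.log_pow] at h1
  push_cast at h1
  rw [average_const_mul, ← avgNorm_rpow hp, Real.log_rpow (avgNorm_pos hc₁ hV k m he),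
    Real.log_mul hc₂.ne' hK.ne', ← mul_sub]
  exact mul_le_mul_of_nonneg_left (by linarith) (by linarith)

end Reducing

end Weight

end MatrixWeight

namespace MatrixWeight

/-! ### The martingales attached to a weight and a function -/

section Local

variable {n d : ℕ} {p K c₁ c₂ : ℝ} {W : (Fin d → ℝ) → Mat n} {D : DyadicGrid d}
  {V : ℤ → (Fin d → ℤ) → Mat n} {f : (Fin d → ℝ) → Vec n}

lemma DyadicGrid.exists_mem_cube (D : DyadicGrid d) (k : ℤ) (x : Fin d → ℝ) :
    ∃ m, x ∈ D.cube k m := by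
  have h2 : (0 : ℝ) < 2 ^ k := by positivity
  refine ⟨fun i => ⌊(x i - D.shift k i) / 2 ^ k⌋, D.mem_cube.2 fun i => ?_⟩
  have h1 := Int.floor_le ((x i - D.shift k i) / 2 ^ k)
  have h3 := Int.lt_floor_add_one ((x i - D.shift k i) / 2 ^ k)
  rw [le_div_iff₀ h2] at h1
  rw [div_lt_iff₀ h2] at h3
  simp only [DyadicGrid.corner]
  constructor <;> linarith

lemma DyadicGrid.iUnion_cube (D : DyadicGrid d) (k : ℤ) : ⋃ m, D.cube k m = Set.univ :=
  Set.eq_univ_of_forall fun x => Set.mem_iUnion.2 (D.exists_mem_cube k x)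

lemma aemeasurable_invRootNorm (hW : IsMatrixApInftyWith p K W) (D : DyadicGrid d) (z : Vec n) :
    AEMeasurable (invRootNorm p W z) := by
  rcases eq_or_ne z 0 with rfl | hz
  · have : invRootNorm p W (0 : Vec n) = fun _ => 0 := by
      funext x; rw [invRootNorm, act_zero, norm_zero]
    rw [this]; exact aemeasurable_const
  rw [← Measure.restrict_univ (μ := volume), ← D.iUnion_cube 0, aemeasurable_iUnion_iff]
  intro m
  have h := (integrableOn_log_invRootNorm (D := D) hW 0 m hz).aemeasurable
  refine (Real.measurable_exp.comp_aemeasurable h).congr ?_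
  filter_upwards [ae_restrict_of_ae (ae_invRootNorm_pos p hW.isMatrixWeight)] with x hx
  exact Real.exp_log (hx z hz)

/-- Measurability of `|W^{-1/p} f|` follows by polarization from that of `|W^{-1/p} z|` for
constant vectors `z`. -/
lemma aemeasurable_norm_act (hW : IsMatrixApInftyWith p K W) (D : DyadicGrid d)
    (hf : AEStronglyMeasurable f) :
    AEMeasurable fun x => ‖act (matPow (W x) (-(1 / p))) (f x)‖ := by
  set A : (Fin d → ℝ) → Mat n := fun x => matPow (W x) (-(1 / p)) with hA
  have hz : ∀ z : Vec n, AEMeasurable fun x => ‖act (A x) z‖ := fun z =>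
    aemeasurable_invRootNorm hW D z
  have hin : ∀ i j : Fin n,
      AEMeasurable fun x => (inner ℂ (act (A x) (stdVec i)) (act (A x) (stdVec j)) : ℂ) := by
    intro i j
    have e : ∀ x, (inner ℂ (act (A x) (stdVec i)) (act (A x) (stdVec j)) : ℂ) =
        ((‖act (A x) (stdVec i + stdVec j)‖ : ℂ) ^ 2
          - (‖act (A x) (stdVec i - stdVec j)‖ : ℂ) ^ 2 +
          ((‖act (A x) (stdVec i - Complex.I • stdVec j)‖ : ℂ) ^ 2 -
            (‖act (A x) (stdVec i + Complex.I • stdVec j)‖ : ℂ) ^ 2) * Complex.I) / 4 := by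
      intro x
      have h := inner_eq_sum_norm_sq_div_four (𝕜 := ℂ) (act (A x) (stdVec i))
        (act (A x) (stdVec j))
      simp only [← actLin_apply, map_add, map_sub, map_smul] at h ⊢
      exact h
    simp only [e]
    have hc : ∀ z : Vec n, AEMeasurable fun x => (‖act (A x) z‖ : ℂ) := fun z =>
      Complex.measurable_ofReal.comp_aemeasurable (hz z)
    exact (((((hc _).pow_const 2).sub ((hc _).pow_const 2)).add
      ((((hc _).pow_const 2).sub ((hc _).pow_const 2)).mul_const _)).div_const _)
  have hfi : ∀ i : Fin n, AEMeasurable fun x => f x i := fun i =>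
    ((EuclideanSpace.proj (𝕜 := ℂ) i).continuous.comp_aestronglyMeasurable hf).aemeasurable
  have hsum : ∀ x, ‖act (A x) (f x)‖ = √(∑ i, ∑ j, (starRingEnd ℂ (f x i)) *
      (f x j * inner ℂ (act (A x) (stdVec i)) (act (A x) (stdVec j)))).re := by
    intro x
    have h1 : act (A x) (f x) = ∑ i, f x i • act (A x) (stdVec i) := by
      nth_rewrite 1 [← sum_smul_stdVec (f x)]
      simp only [← actLin_apply, map_sum, map_smul]
    have h2 : (inner ℂ (act (A x) (f x)) (act (A x) (f x)) : ℂ) =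
        ∑ i, ∑ j, (starRingEnd ℂ (f x i)) *
          (f x j * inner ℂ (act (A x) (stdVec i)) (act (A x) (stdVec j))) := by
      nth_rewrite 1 [h1]
      nth_rewrite 1 [h1]
      simp only [sum_inner, inner_sum, inner_smul_left, inner_smul_right]
      rw [Finset.sum_comm]
      simp only [Finset.mul_sum]
      exact Finset.sum_congr rfl fun i _ => Finset.sum_congr rfl fun j _ => by ring
    have h3 : inner ℂ (act (A x) (f x)) (act (A x) (f x)) =
        ((‖act (A x) (f x)‖ ^ 2 : ℝ) : ℂ) := by
      rw [inner_self_eq_norm_sq_to_K]; simp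
    rw [← h2, h3, Complex.ofReal_re, Real.sqrt_sq (norm_nonneg _)]
  change AEMeasurable fun x => ‖act (A x) (f x)‖
  simp only [hsum]
  refine Real.continuous_sqrt.measurable.comp_aemeasurable
    (Complex.measurable_re.comp_aemeasurable ?_)
  refine Finset.aemeasurable_fun_sum _ fun i _ => Finset.aemeasurable_fun_sum _ fun j _ => ?_
  exact (Complex.continuous_conj.measurable.comp_aemeasurable (hfi i)).mul ((hfi j).mul (hin i j))

/-- The function `|W^{-1/p} f| ^ p'`, whose integral is the `p'`-th power of the norm of `f`. -/
noncomputable abbrev dualDensity (p : ℝ) (W : (Fin d → ℝ) → Mat n) (f : (Fin d → ℝ) → Vec n)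
    (x : Fin d → ℝ) : ℝ :=
  ‖act (matPow (W x) (-(1 / p))) (f x)‖ ^ p.conjExponent

lemma weightedLpNorm_eq (hp : 1 < p) (hW : IsMatrixWeight W) :
    weightedLpNorm p.conjExponent (fun x => matPow (W x) (1 - p.conjExponent)) f =
      (∫⁻ x, ENNReal.ofReal (dualDensity p W f x)) ^ (1 / p.conjExponent) := by
  have hpp := Real.HolderConjugate.conjExponent hp
  rw [weightedLpNorm]
  congr 1
  refine lintegral_congr_ae ?_
  filter_upwards [hW.posDef] with x hx
  have e : (1 - p.conjExponent) * (1 / p.conjExponent) = -(1 / p) := by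
    have h1 := hpp.inv_add_inv_eq_one
    have h2 := hpp.symm.pos.ne'
    have : (1 - p.conjExponent) * (1 / p.conjExponent) = p.conjExponent⁻¹ - 1 := by
      field_simp
    rw [this, one_div]; linarith
  rw [matPow_matPow hx, e, dualDensity, ← ENNReal.ofReal_rpow_of_nonneg (norm_nonneg _)
    hpp.symm.nonneg, ofReal_norm]

variable (hp : 1 < p) (hc₁ : 0 < c₁) (hc₂ : 0 < c₂) (hW : IsMatrixApInftyWith p K W)
  (hV : IsReducingFamily p c₁ c₂ W D V) (hf : AEStronglyMeasurable f)
  (hg : Integrable (dualDensity p W f))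

include hp hc₁ hW hV hf hg in
lemma integrableOn_cube (k : ℤ) (m : Fin d → ℤ) : IntegrableOn f (D.cube k m) := by
  have hpp := Real.HolderConjugate.conjExponent hp
  have hsum : IntegrableOn (fun x => ∑ i : Fin n,
      (rootNorm p W (stdVec i) x ^ p + dualDensity p W f x)) (D.cube k m) :=
    integrable_finsetSum _ fun i _ =>
      (integrableOn_rootNorm hp hc₁ hV k m _).add hg.integrableOn
  refine Integrable.mono' hsum hf.restrict ?_
  filter_upwards [ae_restrict_of_ae (hW.isMatrixWeight.posDef)] with x hx
  refine (norm_le_sum_norm _).trans (Finset.sum_le_sum fun i _ => ?_)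
  rw [← inner_stdVec i (f x)]
  refine (norm_inner_le_of_mul_eq_one (matPow_isHermitian _ _)
    (matPow_mul_matPow_neg hx (1 / p)) _ _).trans ?_
  refine (Real.young_inequality_of_nonneg (norm_nonneg _) (norm_nonneg _) hpp).trans ?_
  exact add_le_add (div_le_self (by positivity) hpp.lt.le)
    (div_le_self (by positivity) hpp.symm.lt.le)

include hp hc₁ hW hV hf hg in
/-- Hölder's inequality for the average of `A f`, `A` a Hermitian matrix. -/
lemma norm_act_average_le {A : Mat n} (hA : A.IsHermitian) (k : ℤ) (m : Fin d → ℤ) :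
    ‖act A (⨍ x in D.cube k m, f x)‖ ≤
      ∑ i, (⨍ x in D.cube k m, rootNorm p W (act A (stdVec i)) x ^ p) ^ (1 / p) *
        (⨍ x in D.cube k m, dualDensity p W f x) ^ (1 / p.conjExponent) := by
  have hpp := Real.HolderConjugate.conjExponent hp
  have hfQ := integrableOn_cube hp hc₁ hW hV hf hg k m
  refine (norm_le_sum_norm _).trans (Finset.sum_le_sum fun i _ => ?_)
  set v : ℝ := ((2 : ℝ) ^ k) ^ d with hv
  have hv0 : 0 < v := by positivity
  have hα := integrableOn_rootNorm hp hc₁ hV k m (act A (stdVec i))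
  have hpos := hpp.pos
  have hpos' := hpp.symm.pos
  have e1 : (act A (⨍ x in D.cube k m, f x)) i =
      v⁻¹ • ∫ x in D.cube k m, inner ℂ (act A (stdVec i)) (f x) := by
    rw [← inner_stdVec i (act A _), ← inner_act hA, D.setAverage_cube_eq, inner_smul_right_eq_smul,
      integral_inner hfQ]
  have hmeas : AEStronglyMeasurable (rootNorm p W (act A (stdVec i)))
      (volume.restrict (D.cube k m)) := by
    have : AEStronglyMeasurable (fun x => (rootNorm p W (act A (stdVec i)) x ^ p) ^ (1 / p))
        (volume.restrict (D.cube k m)) :=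
      (hα.aemeasurable.pow_const _).aestronglyMeasurable
    refine this.congr ?_
    filter_upwards with x
    rw [← Real.rpow_mul (norm_nonneg _), mul_one_div_cancel hpos.ne', Real.rpow_one]
  have h1 : ‖∫ x in D.cube k m, inner ℂ (act A (stdVec i)) (f x)‖ ≤
      ∫ x in D.cube k m, rootNorm p W (act A (stdVec i)) x *
        ‖act (matPow (W x) (-(1 / p))) (f x)‖ := by
    refine norm_integral_le_of_norm_le ?_ ?_
    · refine Integrable.mono' (hα.add hg.integrableOn) ?_ ?_
      · exact hmeas.mul (aemeasurable_norm_act hW D hf).aestronglyMeasurable.restrict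
      · filter_upwards with x
        rw [Real.norm_of_nonneg (by positivity)]
        refine (Real.young_inequality_of_nonneg (norm_nonneg _) (norm_nonneg _) hpp).trans ?_
        exact add_le_add (div_le_self (by positivity) hpp.lt.le)
          (div_le_self (by positivity) hpp.symm.lt.le)
    · filter_upwards [ae_restrict_of_ae (hW.isMatrixWeight.posDef)] with x hx
      exact norm_inner_le_of_mul_eq_one (matPow_isHermitian _ _)
        (matPow_mul_matPow_neg hx (1 / p)) _ _
  have hm1 : MemLp (rootNorm p W (act A (stdVec i))) (ENNReal.ofReal p)
      (volume.restrict (D.cube k m)) := by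
    rw [← integrable_norm_rpow_iff hmeas (by simpa using hpos) ENNReal.ofReal_ne_top,
      ENNReal.toReal_ofReal hpos.le]
    simp only [norm_norm]
    exact hα
  have hm2 : MemLp (fun x => ‖act (matPow (W x) (-(1 / p))) (f x)‖)
      (ENNReal.ofReal p.conjExponent) (volume.restrict (D.cube k m)) := by
    rw [← integrable_norm_rpow_iff (aemeasurable_norm_act hW D hf).aestronglyMeasurable.restrict
      (by simpa using hpos') ENNReal.ofReal_ne_top, ENNReal.toReal_ofReal hpos'.le]
    simp only [norm_norm]
    exact hg.integrableOn
  have h2 := integral_mul_le_Lp_mul_Lq_of_nonneg hpp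
    (Filter.Eventually.of_forall fun x => norm_nonneg _)
    (Filter.Eventually.of_forall fun x => norm_nonneg _) hm1 hm2
  rw [e1, norm_smul, Real.norm_of_nonneg (by positivity), D.setAverage_cube_eq,
    D.setAverage_cube_eq, smul_eq_mul, smul_eq_mul,
    Real.mul_rpow (by positivity) (integral_nonneg fun x => by positivity),
    Real.mul_rpow (by positivity) (integral_nonneg fun x => by positivity)]
  have e2 : v⁻¹ = v⁻¹ ^ (1 / p) * v⁻¹ ^ (1 / p.conjExponent) := by
    rw [← Real.rpow_add (by positivity), one_div, one_div, hpp.inv_add_inv_eq_one, Real.rpow_one]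
  rw [← hv]
  nth_rewrite 1 [e2]
  refine (mul_le_mul_of_nonneg_left (h1.trans h2) (by positivity)).trans (le_of_eq ?_)
  ring

end Local

end MatrixWeight

namespace MatrixWeight

section Local

variable {n d : ℕ} {p K c₁ c₂ : ℝ} {W : (Fin d → ℝ) → Mat n} {D : DyadicGrid d}
  {V : ℤ → (Fin d → ℤ) → Mat n} {f : (Fin d → ℝ) → Vec n}

/-- The reducing matrix of the cube at a node. -/
noncomputable def DyadicGrid.nodeMat (D : DyadicGrid d) (V : ℤ → (Fin d → ℤ) → Mat n) (k : ℤ)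
    (m : Fin d → ℤ) (l : List (Fin d → Bool)) : Mat n :=
  V (k - l.length) (D.nodeIdx k m l)

/-- The contribution `∑_ε |V_I⁻¹ f_I^ε|² / |I|` of the cube at a node to the square function. -/
noncomputable def DyadicGrid.nodeCoeff (D : DyadicGrid d) (V : ℤ → (Fin d → ℤ) → Mat n)
    (f : (Fin d → ℝ) → Vec n) (k : ℤ) (m : Fin d → ℤ) (l : List (Fin d → Bool)) : ℝ :=
  ∑ ε ∈ signatures d, ‖act (D.nodeMat V k m l)⁻¹ (D.haarCoeff f (k - l.length)
    (D.nodeIdx k m l) ε)‖ ^ 2 / ((2 : ℝ) ^ (k - (l.length : ℤ))) ^ d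

lemma integrableOn_posLog_rootNorm (hp : 1 < p) (hc₁ : 0 < c₁) (hW : IsMatrixApInftyWith p K W)
    (hV : IsReducingFamily p c₁ c₂ W D V) (k : ℤ) (m : Fin d → ℤ) {e : Vec n} (he : e ≠ 0) :
    IntegrableOn (fun x => max 0 (Real.log (rootNorm p W e x))) (D.cube k m) := by
  have h := integrableOn_log_rootNorm hp hc₁ hW hV k m he
  have h0 : IntegrableOn (fun _ : Fin d → ℝ => (0 : ℝ)) (D.cube k m) := integrableOn_zero
  exact h0.sup h

/-- The square function estimate on a dyadic cube, for finitely many generations. -/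
lemma exists_treeAvg_nodeCoeff_le (n d : ℕ) {p : ℝ} (hp : 1 < p) (K : ℝ) {c₁ c₂ : ℝ}
    (hc₁ : 0 < c₁) (hc₂ : 0 < c₂) :
    ∃ C : ℝ, 0 ≤ C ∧ ∀ W : (Fin d → ℝ) → Mat n, IsMatrixApInftyWith p K W →
      ∀ (D : DyadicGrid d) (V : ℤ → (Fin d → ℤ) → Mat n), IsReducingFamily p c₁ c₂ W D V →
      ∀ f : (Fin d → ℝ) → Vec n, AEStronglyMeasurable f → Integrable (dualDensity p W f) →
      ∀ (k : ℤ) (m : Fin d → ℤ) (N : ℕ),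
        treeAvg N (fun u => √(pathSum (D.nodeCoeff V f k m) u) ^ p.conjExponent) [] ≤
          C * ⨍ x in D.cube k m, dualDensity p W f x := by
  have hpp := Real.HolderConjugate.conjExponent hp
  set M : ℝ := (|K| + 1) / c₁ with hM
  have hM0 : 0 < M := by positivity
  obtain ⟨C, hC, h⟩ := exists_treeAvg_pathSum_rpow_le hpp n (B := 2 ^ d) (κ := 2 ^ d)
    (c := n * (|Real.log M| + c₂ ^ p) + 1) (C₂ := n * c₂)
    (Cw := p * Real.log (c₂ * M)) (A := c₂ ^ p) (by positivity) (by positivity) (by positivity)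
    (by positivity)
  refine ⟨C, hC, fun W hW D V hV f hf hg k m N => ?_⟩
  have hcard : (Fintype.card (Fin d → Bool) : ℝ) = 2 ^ d := by simp
  set A : List (Fin d → Bool) → Mat n := D.nodeMat V k m with hA
  have hApos : ∀ l, (A l).PosDef := fun l => hV.posDef _ _
  set T : List (Fin d → Bool) → Vec n →ₗ[ℝ] Vec n := fun l =>
    (actLin (A l)⁻¹).restrictScalars ℝ with hT
  have hTa : ∀ l v, T l v = act (A l)⁻¹ v := fun l v => rfl
  have he1 : ∀ J (i : Fin n), act (A J)⁻¹ (stdVec i) ≠ 0 := fun J i => by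
    rw [← norm_pos_iff]
    exact norm_act_pos (mul_inv_of_posDef (hApos J)) (stdVec_ne_zero i)
  have he2 : ∀ J (i : Fin n), act (A J) (stdVec i) ≠ 0 := fun J i =>
    act_ne_zero (hApos J) (stdVec_ne_zero i)
  -- the averages below the node `J` are averages over the nodes `u ++ J` of the whole tree
  have hmart : ∀ {F : (Fin d → ℝ) → ℝ} (J : List (Fin d → Bool)),
      IntegrableOn F (D.cube k m) → IsTreeMart N fun u => D.nodeAvg k m F (u ++ J) := by
    intro F J hF
    exact (D.isTreeMart_nodeAvg hF (N + J.length)).append J le_rfl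
  -- the logarithm of `|W^{-1/p} V_J e_i|`, made nonnegative; its averages bound the logarithm of
  -- `|V_I⁻¹ V_J e_i|` for the cubes `I` inside `J`
  set φ : List (Fin d → Bool) → Fin n → (Fin d → ℝ) → ℝ := fun J i x =>
    Real.log (invRootNorm p W (act (A J) (stdVec i)) x) +
      max 0 (Real.log (rootNorm p W (act (A J)⁻¹ (stdVec i)) x)) with hφ
  have hφint : ∀ J i k m, IntegrableOn (φ J i) (D.cube k m) := fun J i k m =>
    (integrableOn_log_invRootNorm hW k m (he2 J i)).add
      (integrableOn_posLog_rootNorm hp hc₁ hW hV k m (he1 J i))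
  have hφ0 : ∀ J i, ∀ᵐ x, 0 ≤ φ J i x := by
    intro J i
    filter_upwards [ae_rootNorm_pos p hW.isMatrixWeight, ae_invRootNorm_pos p hW.isMatrixWeight,
      ae_norm_inner_le p hW.isMatrixWeight] with x ha hb hi
    have h1 := hi (act (A J)⁻¹ (stdVec i)) (act (A J) (stdVec i))
    rw [inner_act (inv_isHermitian (hApos J)), act_inv_act (hApos J),
      inner_self_eq_norm_sq_to_K, norm_stdVec] at h1
    have h2 := Real.log_le_log (by simp) h1
    rw [Real.log_mul (ha _ (he1 J i)).ne' (hb _ (he2 J i)).ne'] at h2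
    simp only [RCLike.ofReal_one, one_pow, norm_one, Real.log_one] at h2
    have := le_max_right 0 (Real.log (rootNorm p W (act (A J)⁻¹ (stdVec i)) x))
    simp only [hφ]
    linarith
  have hψ0 : ∀ J i k m, 0 ≤ ⨍ x in D.cube k m, φ J i x := fun J i k m => by
    rw [← average_const (D := D) k m 0]
    exact average_mono integrableOn_zero (hφint J i k m) (hφ0 J i)
  set g : List (Fin d → Bool) → ℝ := D.nodeAvg k m (dualDensity p W f) with hgdef
  have g0 : ∀ l, 0 ≤ g l := fun l => by
    simp only [hgdef, DyadicGrid.nodeAvg]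
    rw [setAverage_eq, smul_eq_mul]
    exact mul_nonneg (by positivity) (integral_nonneg fun x => by positivity)
  have w0 : ∀ k m (e : Vec n), e ≠ 0 → 0 < ⨍ x in D.cube k m, rootNorm p W e x ^ p :=
    fun k m e he => by
      rw [← avgNorm_rpow hp]
      exact Real.rpow_pos_of_pos (avgNorm_pos hc₁ hV k m he) p
  have wle : ∀ (J : List (Fin d → Bool)) (i : Fin n),
      ⨍ x in D.nodeCube k m J, rootNorm p W (act (A J)⁻¹ (stdVec i)) x ^ p ≤ c₂ ^ p := by
    intro J i
    rw [DyadicGrid.nodeCube, ← avgNorm_rpow hp]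
    refine Real.rpow_le_rpow (avgNorm_pos hc₁ hV _ _ (he1 J i)).le ?_ (by linarith)
    refine (hV.upper _ _ _).trans (le_of_eq ?_)
    have : act (V (k - J.length) (D.nodeIdx k m J)) (act (A J)⁻¹ (stdVec i)) = stdVec i :=
      act_act_inv (hApos J) _
    rw [this, norm_stdVec, mul_one]
  have hpart : ∀ J (i : Fin n) l, ‖act (A l)⁻¹ (act (A J) (stdVec i))‖ ≤
      c₂ * Real.exp (⨍ x in D.nodeCube k m l, φ J i x) := by
    intro J i l
    refine (norm_act_inv_le hp hc₁ hc₂ hW hV _ _ (he2 J i)).trans ?_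
    refine mul_le_mul_of_nonneg_left (Real.exp_le_exp.2 ?_) hc₂.le
    refine average_mono (integrableOn_log_invRootNorm hW _ _ (he2 J i)) (hφint J i _ _) ?_
    filter_upwards with x
    exact le_add_of_nonneg_right (le_max_left _ _)
  -- `γ` has to be positive, hence the perturbation by `η`
  have key : ∀ η : ℝ, 0 < η →
      treeAvg N (fun u => √(pathSum (D.nodeCoeff V f k m) u) ^ p.conjExponent) [] ≤
        C * (g [] + η) := by
    intro η hη
    refine h (Fin d → Bool) hcard (Vec n) N T (D.nodeAvg k m f) (D.nodeCoeff V f k m)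
      (fun l => g l + η)
      (fun J i u => D.nodeAvg k m (fun x => rootNorm p W (act (A J)⁻¹ (stdVec i)) x ^ p) (u ++ J))
      (fun J i u => D.nodeAvg k m
        (fun x => p * Real.log (rootNorm p W (act (A J)⁻¹ (stdVec i)) x)) (u ++ J))
      (fun J u => ∑ i, D.nodeAvg k m (φ J i) (u ++ J))
      (D.isTreeMart_nodeAvg (integrableOn_cube hp hc₁ hW hV hf hg k m) N) ?_ ?_ ?_ ?_ ?_ ?_ ?_ ?_
      ?_ ?_ ?_ ?_ ?_ ?_ ?_
    · intro l hl
      rw [childAvg_add, childAvg_const, D.isTreeMart_nodeAvg hg.integrableOn N l hl]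
    · exact fun J i => hmart J (integrableOn_rootNorm hp hc₁ hV k m _)
    · exact fun J i => hmart J ((integrableOn_log_rootNorm hp hc₁ hW hV k m (he1 J i)).const_mul p)
    · intro J l hl
      have e : childAvg (fun u => ∑ i, D.nodeAvg k m (φ J i) (u ++ J)) l =
          ∑ i, childAvg (fun u => D.nodeAvg k m (φ J i) (u ++ J)) l := by
        simp only [childAvg]
        rw [Finset.sum_comm, Finset.smul_sum]
      rw [e]
      exact Finset.sum_congr rfl fun i _ => hmart J (hφint J i k m) l hl
    · exact fun l => Finset.sum_nonneg fun ε _ => by positivity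
    · exact fun l => by have := g0 l; positivity
    · exact fun J i l => w0 _ _ _ (he1 J i)
    · exact fun J l => Finset.sum_nonneg fun i _ => hψ0 J i _ _
    · exact fun J i l => log_average_rootNorm_le hp hc₁ hc₂ hW hV _ _ (he1 J i)
    · exact fun J i l => average_log_rootNorm_le hp hc₁ hW hV _ _ (he1 J i)
    · exact fun J i => wle J i
    · intro J
      have hi : ∀ i, D.nodeAvg k m (φ J i) ([] ++ J) ≤ |Real.log M| + c₂ ^ p := by
        intro i
        simp only [DyadicGrid.nodeAvg, DyadicGrid.nodeCube, List.nil_append, hφ]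
        rw [average_add (integrableOn_log_invRootNorm hW _ _ (he2 J i))
          (integrableOn_posLog_rootNorm hp hc₁ hW hV _ _ (he1 J i))]
        refine add_le_add ?_ ?_
        · have h1 := exp_average_log_invRootNorm_le hc₁ hW hV (k - J.length) (D.nodeIdx k m J)
            (he2 J i)
          have e : act (V (k - J.length) (D.nodeIdx k m J))⁻¹ (act (A J) (stdVec i)) = stdVec i :=
            act_inv_act (hApos J) _
          rw [e, norm_stdVec, mul_one, ← Real.le_log_iff_exp_le hM0] at h1
          exact h1.trans (le_abs_self _)
        · refine (average_mono (integrableOn_posLog_rootNorm hp hc₁ hW hV _ _ (he1 J i))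
            (integrableOn_rootNorm hp hc₁ hV _ _ _) ?_).trans (wle J i)
          filter_upwards [ae_rootNorm_pos p hW.isMatrixWeight] with x hx
          have a0 := hx _ (he1 J i)
          have h3 := Real.rpow_pos_of_pos a0 p
          refine max_le h3.le ?_
          have h6 := Real.log_le_sub_one_of_pos h3
          rw [Real.log_rpow a0] at h6
          by_contra! h8
          nlinarith
      refine (Finset.sum_le_sum fun i _ => hi i).trans ?_
      rw [Finset.sum_const, Finset.card_univ, Fintype.card_fin, nsmul_eq_mul]
      linarith
    · intro J u
      refine (norm_act_average_le hp hc₁ hW hV hf hg (inv_isHermitian (hApos J)) _ _).trans ?_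
      refine Finset.sum_le_sum fun i _ => ?_
      refine mul_le_mul_of_nonneg_left ?_ (Real.rpow_nonneg (w0 _ _ _ (he1 J i)).le _)
      refine Real.rpow_le_rpow (g0 (u ++ J)) ?_ (by have := hpp.symm.pos; positivity)
      exact le_add_of_nonneg_right hη.le
    · intro J u y
      simp only [hTa]
      set z := act (A J)⁻¹ y with hz
      have hy : y = act (A J) z := (act_act_inv (hApos J) y).symm
      have e : act (A (u ++ J))⁻¹ y =
          ∑ i, z i • act (A (u ++ J))⁻¹ (act (A J) (stdVec i)) := by
        rw [hy]
        nth_rewrite 1 [← sum_smul_stdVec z]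
        simp only [← actLin_apply, map_sum, map_smul]
      rw [e]
      refine (norm_sum_le _ _).trans ?_
      have hi : ∀ i, ‖z i • act (A (u ++ J))⁻¹ (act (A J) (stdVec i))‖ ≤
          ‖z‖ * (c₂ * Real.exp (∑ i, D.nodeAvg k m (φ J i) (u ++ J))) := by
        intro i
        rw [norm_smul]
        refine mul_le_mul (PiLp.norm_apply_le z i) ((hpart J i _).trans ?_)
          (norm_nonneg _) (norm_nonneg _)
        refine mul_le_mul_of_nonneg_left (Real.exp_le_exp.2 ?_) hc₂.le
        exact Finset.single_le_sum (f := fun i => D.nodeAvg k m (φ J i) (u ++ J))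
          (fun i _ => hψ0 J i _ _) (Finset.mem_univ i)
      refine (Finset.sum_le_sum fun i _ => hi i).trans (le_of_eq ?_)
      rw [Finset.sum_const, Finset.card_univ, Fintype.card_fin, nsmul_eq_mul]
      ring
    · intro l
      exact D.sum_haarCoeff_le (integrableOn_cube hp hc₁ hW hV hf hg k m) (T l) l
  -- let the perturbation tend to zero
  have hlim : Filter.Tendsto (fun η : ℝ => C * (g [] + η)) (nhdsWithin 0 (Set.Ioi 0))
      (nhds (C * (g [] + 0))) :=
    ((continuous_const.mul (continuous_const.add continuous_id)).tendsto 0).mono_left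
      nhdsWithin_le_nhds
  rw [add_zero] at hlim
  have := ge_of_tendsto hlim (Filter.eventually_of_mem self_mem_nhdsWithin key)
  refine this.trans (le_of_eq ?_)
  simp [hgdef, DyadicGrid.nodeAvg, DyadicGrid.nodeCube, DyadicGrid.nodeIdx]

end Local

end MatrixWeight

namespace MatrixWeight

/-! ### Passage to the whole grid -/

section Global

variable {n d : ℕ} {V : ℤ → (Fin d → ℤ) → Mat n} {f : (Fin d → ℝ) → Vec n}

lemma DyadicGrid.eq_of_mem_cube (D : DyadicGrid d) {k : ℤ} {m m' : Fin d → ℤ} {x : Fin d → ℝ}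
    (h : x ∈ D.cube k m) (h' : x ∈ D.cube k m') : m = m' := by
  have h2 : (0 : ℝ) < 2 ^ k := by positivity
  rw [D.mem_cube] at h h'
  have key : ∀ {a b : ℤ} {s y : ℝ}, s + a * (2 : ℝ) ^ k ≤ y → y < s + b * (2 : ℝ) ^ k + 2 ^ k →
      a ≤ b := by
    intro a b s y h1 h2'
    have h3 : (a : ℝ) * 2 ^ k < (b + 1) * 2 ^ k := by linarith
    have h4 : (a : ℝ) < b + 1 := lt_of_mul_lt_mul_right h3 h2.le
    exact Int.lt_add_one_iff.1 (by exact_mod_cast h4)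
  funext i
  exact le_antisymm (key (h i).1 (h' i).2) (key (h' i).1 (h i).2)

/-- The contribution of the `m`-th cube of generation `k` to the square of the square function. -/
noncomputable def sqTerm (D : DyadicGrid d) (V : ℤ → (Fin d → ℤ) → Mat n)
    (f : (Fin d → ℝ) → Vec n) (k : ℤ) (m : Fin d → ℤ) (x : Fin d → ℝ) : ℝ≥0∞ :=
  ∑ ε ∈ signatures d, (D.cube k m).indicator
    (fun _ => ‖act (V k m)⁻¹ (D.haarCoeff f k m ε)‖ₑ ^ 2 / volume (D.cube k m)) x

/-- The square of the square function, restricted to the cubes of generation `-M < k ≤ M`. -/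
noncomputable def sqPartial (D : DyadicGrid d) (V : ℤ → (Fin d → ℤ) → Mat n)
    (f : (Fin d → ℝ) → Vec n) (M : ℕ) (x : Fin d → ℝ) : ℝ≥0∞ :=
  ∑ k ∈ Finset.Ioc (-(M : ℤ)) M, ∑' m, sqTerm D V f k m x

lemma measurable_sqPartial (D : DyadicGrid d) (V : ℤ → (Fin d → ℤ) → Mat n)
    (f : (Fin d → ℝ) → Vec n) (M : ℕ) : Measurable (sqPartial D V f M) := by
  refine Finset.measurable_fun_sum _ fun k _ => Measurable.tsum fun m => ?_
  exact Finset.measurable_fun_sum _ fun ε _ =>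
    measurable_const.indicator (D.measurableSet_cube k m)

lemma monotone_sqPartial (D : DyadicGrid d) (V : ℤ → (Fin d → ℤ) → Mat n)
    (f : (Fin d → ℝ) → Vec n) (x : Fin d → ℝ) : Monotone fun M => sqPartial D V f M x := by
  intro M M' h
  refine Finset.sum_le_sum_of_subset (Finset.Ioc_subset_Ioc ?_ ?_) <;> omega

lemma sqSum_eq_iSup (D : DyadicGrid d) (V : ℤ → (Fin d → ℤ) → Mat n)
    (f : (Fin d → ℝ) → Vec n) (x : Fin d → ℝ) : sqSum D V f x = ⨆ M, sqPartial D V f M x := by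
  refine ENNReal.tsum_eq_iSup_sum' (fun M : ℕ => Finset.Ioc (-(M : ℤ)) M) fun t => ?_
  refine ⟨t.sup Int.natAbs + 1, fun k hk => ?_⟩
  have := Finset.le_sup (f := Int.natAbs) hk
  rw [Finset.mem_Ioc]
  omega

lemma sqTerm_of_mem (D : DyadicGrid d) {k : ℤ} {m : Fin d → ℤ} {l : List (Fin d → Bool)}
    {x : Fin d → ℝ} (hx : x ∈ D.nodeCube k m l) :
    ∑' m', sqTerm D V f (k - l.length) m' x = ENNReal.ofReal (D.nodeCoeff V f k m l) := by
  have h2 : (0 : ℝ) < ((2 : ℝ) ^ (k - (l.length : ℤ))) ^ d := by positivity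
  rw [tsum_eq_single (D.nodeIdx k m l), sqTerm, DyadicGrid.nodeCoeff,
    ENNReal.ofReal_sum_of_nonneg fun ε _ => by positivity]
  · refine Finset.sum_congr rfl fun ε _ => ?_
    rw [Set.indicator_of_mem (show x ∈ D.cube _ _ from hx), D.volume_cube,
      ENNReal.ofReal_div_of_pos h2, ENNReal.ofReal_pow (norm_nonneg _), ofReal_norm]
    rfl
  · intro m' hm'
    refine Finset.sum_eq_zero fun ε _ => Set.indicator_of_notMem (fun h => hm' ?_) _
    exact D.eq_of_mem_cube h hx

lemma sum_sqTerm_of_mem (D : DyadicGrid d) {k : ℤ} {m : Fin d → ℤ} {l : List (Fin d → Bool)}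
    {x : Fin d → ℝ} (hx : x ∈ D.nodeCube k m l) :
    ∑ k' ∈ Finset.Ioc (k - l.length) k, ∑' m', sqTerm D V f k' m' x =
      ENNReal.ofReal (pathSum (D.nodeCoeff V f k m) l) := by
  induction l with
  | nil => simp [pathSum]
  | cons c l ih =>
    have hx' : x ∈ D.nodeCube k m l := D.nodeCube_append_subset k m [c] l hx
    have e : Finset.Ioc (k - ((c :: l).length : ℤ)) k =
        insert (k - (l.length : ℤ)) (Finset.Ioc (k - l.length) k) := by
      ext j; simp only [Finset.mem_Ioc, Finset.mem_insert, List.length_cons]; push_cast; omega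
    have h0 : ∀ l, 0 ≤ D.nodeCoeff V f k m l := fun l =>
      Finset.sum_nonneg fun ε _ => by positivity
    rw [e, Finset.sum_insert (by simp), ih hx', sqTerm_of_mem D hx',
      ← ENNReal.ofReal_add (h0 l) (pathSum_nonneg h0 l), pathSum, add_comm]

end Global

/-- The square function estimate, by monotone convergence from the cubes of generation
`-M < k ≤ M`, which form trees of depth `2 * M` below the cubes of generation `M`. -/
lemma lintegral_sqSum_rpow_le (n d : ℕ) {p : ℝ} (hp : 1 < p) (K : ℝ) {c₁ c₂ : ℝ}
    (hc₁ : 0 < c₁) (hc₂ : 0 < c₂) :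
    ∃ C : ℝ≥0, ∀ W : (Fin d → ℝ) → Mat n, IsMatrixApInftyWith p K W →
      ∀ (D : DyadicGrid d) (V : ℤ → (Fin d → ℤ) → Mat n), IsReducingFamily p c₁ c₂ W D V →
      ∀ f : (Fin d → ℝ) → Vec n, AEStronglyMeasurable f → Integrable (dualDensity p W f) →
        ∫⁻ x, sqSum D V f x ^ (p.conjExponent / 2) ≤
          C * ∫⁻ x, ENNReal.ofReal (dualDensity p W f x) := by
  obtain ⟨C, hC, h⟩ := exists_treeAvg_nodeCoeff_le n d hp K hc₁ hc₂
  refine ⟨C.toNNReal, fun W hW D V hV f hf hg => ?_⟩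
  have hq : 0 < p.conjExponent := (Real.HolderConjugate.conjExponent hp).symm.pos
  have hq2 : 0 < p.conjExponent / 2 := by positivity
  have hcube : ∀ (M : ℕ) (m : Fin d → ℤ),
      ∫⁻ x in D.cube M m, sqPartial D V f M x ^ (p.conjExponent / 2) ≤
        C.toNNReal * ∫⁻ x in D.cube M m, ENNReal.ofReal (dualDensity p W f x) := by
    intro M m
    have e0 : D.cube M m = D.nodeCube M m [] := by simp [DyadicGrid.nodeCube, DyadicGrid.nodeIdx]
    have hleaf : ∀ v : List (Fin d → Bool), v.length = 2 * M → ∀ x ∈ D.nodeCube M m (v ++ []),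
        sqPartial D V f M x ^ (p.conjExponent / 2) =
          ENNReal.ofReal (√(pathSum (D.nodeCoeff V f M m) (v ++ [])) ^ p.conjExponent) := by
      intro v hv x hx
      rw [List.append_nil] at hx ⊢
      have h0 : 0 ≤ pathSum (D.nodeCoeff V f M m) v :=
        pathSum_nonneg (fun l => Finset.sum_nonneg fun ε _ => by positivity) v
      have e1 := sum_sqTerm_of_mem (V := V) (f := f) D hx
      have e2 : (M : ℤ) - v.length = -M := by rw [hv]; push_cast; ring
      rw [e2] at e1
      rw [sqPartial, e1, ENNReal.ofReal_rpow_of_nonneg h0 hq2.le, Real.sqrt_eq_rpow,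
        ← Real.rpow_mul h0]
      congr 2
      ring
    rw [e0, D.setLIntegral_nodeCube
      (F := fun u => √(pathSum (D.nodeCoeff V f M m) u) ^ p.conjExponent)
      (fun l => by positivity) hleaf, ← e0]
    have hint : volume (D.cube M m) * ENNReal.ofReal (⨍ x in D.cube M m, dualDensity p W f x) =
        ∫⁻ x in D.cube M m, ENNReal.ofReal (dualDensity p W f x) := by
      rw [← ofReal_integral_eq_lintegral_ofReal hg.integrableOn
        (Filter.Eventually.of_forall fun x => by positivity), D.setAverage_cube_eq, D.volume_cube,
        ← ENNReal.ofReal_mul (by positivity), smul_eq_mul, mul_inv_cancel_left₀ (by positivity)]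
    calc volume (D.cube M m) * ENNReal.ofReal _
        ≤ volume (D.cube M m) * ENNReal.ofReal (C * ⨍ x in D.cube M m, dualDensity p W f x) := by
          gcongr
          exact h W hW D V hV f hf hg M m (2 * M)
      _ = C.toNNReal * (volume (D.cube M m) *
            ENNReal.ofReal (⨍ x in D.cube M m, dualDensity p W f x)) := by
          rw [ENNReal.ofReal_mul hC, ENNReal.ofReal]; ring
      _ = _ := by rw [hint]
  have hall : ∀ (M : ℕ) (F : (Fin d → ℝ) → ℝ≥0∞), ∫⁻ x, F x = ∑' m, ∫⁻ x in D.cube M m, F x := by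
    intro M F
    rw [← lintegral_iUnion (fun m => D.measurableSet_cube M m), D.iUnion_cube,
      Measure.restrict_univ]
    intro m m' hm
    exact Set.disjoint_left.2 fun x hx hx' => hm (D.eq_of_mem_cube hx hx')
  have hpart : ∀ M : ℕ, ∫⁻ x, sqPartial D V f M x ^ (p.conjExponent / 2) ≤
      C.toNNReal * ∫⁻ x, ENNReal.ofReal (dualDensity p W f x) := by
    intro M
    rw [hall M, hall M, ← ENNReal.tsum_mul_left]
    exact ENNReal.tsum_le_tsum fun m => hcube M m
  have e : ∀ x, sqSum D V f x ^ (p.conjExponent / 2) =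
      ⨆ M, sqPartial D V f M x ^ (p.conjExponent / 2) := by
    intro x
    rw [sqSum_eq_iSup]
    exact (ENNReal.orderIsoRpow _ hq2).map_iSup _
  simp only [e]
  rw [lintegral_iSup (fun M => (measurable_sqPartial D V f M).pow_const _)
    fun M M' hM x => ENNReal.rpow_le_rpow (monotone_sqPartial D V f x hM) hq2.le]
  exact iSup_le hpart

end MatrixWeight

theorem mainTheorem3 (n d : ℕ) (p : ℝ) (hp : 1 < p) (K c₁ c₂ : ℝ) (hc₁ : 0 < c₁) (hc₂ : 0 < c₂) :
    ∃ C : ℝ≥0, ∀ W : (Fin d → ℝ) → MatrixWeight.Mat n, MatrixWeight.IsMatrixApInftyWith p K W →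
      ∀ (D : MatrixWeight.DyadicGrid d) (V : ℤ → (Fin d → ℤ) → MatrixWeight.Mat n),
        MatrixWeight.IsReducingFamily p c₁ c₂ W D V →
      ∀ f : (Fin d → ℝ) → MatrixWeight.Vec n,
        MatrixWeight.MemWeightedLp p.conjExponent
          (fun x => MatrixWeight.matPow (W x) (1 - p.conjExponent)) f →
        (∫⁻ x, MatrixWeight.sqSum D V f x ^ (p.conjExponent / 2)) ^ (1 / p.conjExponent)
          ≤ C * MatrixWeight.weightedLpNorm p.conjExponent
              (fun x => MatrixWeight.matPow (W x) (1 - p.conjExponent)) f := by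
  obtain ⟨C, hC⟩ := MatrixWeight.lintegral_sqSum_rpow_le n d hp K hc₁ hc₂
  have hq : 0 < p.conjExponent := (Real.HolderConjugate.conjExponent hp).symm.pos
  have hq' : 0 < 1 / p.conjExponent := by positivity
  refine ⟨C ^ (1 / p.conjExponent), fun W hW D V hV f hf => ?_⟩
  have hnorm := MatrixWeight.weightedLpNorm_eq (f := f) hp hW.isMatrixWeight
  have hfin : ∫⁻ x, ENNReal.ofReal (MatrixWeight.dualDensity p W f x) < ∞ := by
    have h := hf.2
    rw [hnorm] at h
    exact (ENNReal.rpow_lt_top_iff_of_pos hq').1 h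
  have hg : Integrable (MatrixWeight.dualDensity p W f) := by
    refine ⟨((MatrixWeight.aemeasurable_norm_act hW D hf.1).pow_const _).aestronglyMeasurable, ?_⟩
    rwa [hasFiniteIntegral_iff_ofReal (Filter.Eventually.of_forall fun x => by positivity)]
  rw [hnorm, ENNReal.coe_rpow_of_nonneg _ hq'.le, ← ENNReal.mul_rpow_of_nonneg _ _ hq'.le]
  exact ENNReal.rpow_le_rpow (hC W hW D V hV f hf.1 hg) hq'.le
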